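/- **Conventions.** All manifolds (without boundary), metrics and distributions are smooth. Let $(M,g)$ be an $n$-dimensional semi-Riemannian manifold of (constant) index $q$. A tangent vector $v$ is *timelike* if $g(v,v)<0$, *lightlike* if $g(v,v)=0$ and $v\neq 0$, and *causal* if it is timelike or lightlike. A *space distribution* $H$ is an $(n-q)$-plane distribution on which $g$ is positive definite; its $g$-orthogonal complement $V$ then satisfies $TM=V\oplus H$, and $g$ is negative definite on $V$. Write $v=v_V+v_H$ for the corresponding decomposition, and put $g_V=-g|_V$, $g_H=g|_H$. * For a smooth $f\colon M\to\mathbb R_{>0}$ let $\mathrm{stretch}(g,f,V)=\bigl(-\tfrac1{f^2}g_V\bigr)\oplus g_H$; let $h=g_V\oplus g_H$, a Riemannian metric with norm $|v|_h$. * For $u,v\in H_x$, $w\in V_x$ let $\mathrm{Tw}(u,v,w)=g([\hat u,\hat v],w)$, where $\hat u,\hat v$ are local sections of $H$ with values $u,v$ at $x$ (the choice does not matter). * For a subbundle $U$ on which $g$ is nondegenerate, $\mathrm{tr}_{U}^aB(a,a)=\sum_\nu g(e_\nu,e_\nu)B(e_\nu,e_\nu)$ for a $g$-orthonormal basis $(e_\nu)$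 of $U_x$; $\mathrm{tr}_g$ is the case $U=TM$. * $b$ is the symmetric bilinear form field with $b(v,w)=-2\,\mathrm{tr}_H^a\mathrm{tr}_V^c\,\mathrm{Tw}(v,a,c)\mathrm{Tw}(w,a,c)$ for $v,w\in H$, $b(v,w)=\mathrm{tr}_H^a\mathrm{tr}_H^c\,\mathrm{Tw}(a,c,v)\mathrm{Tw}(a,c,w)$ for $v,w\in V$, and $b(v,w)=0$ for $v\in V$, $w\in H$. Let $\beta=b-\tfrac12\mathrm{tr}_g(b)\,g$. * $\sharp_g\colon T^*M\to TM$ is the isomorphism induced by $g$; we write $\sharp=\sharp_g$. $(M,g,H)$ is *weak energy nice*, resp. *semi-dominant energy nice*, resp. *causal convergence nice on* $K\subseteq M$ if there is a constant $c>0$ such that for all $x\in K$ and all $g$-causal $v\in T_xM$ with $|v|_h\ge1$ we have $\beta(v,v)\ge c$, resp. $-g\bigl(\sharp(\beta(v,\cdot)),\sharp(\beta(v,\cdot))\bigr)\ge c$, resp. $b(v,v)\ge c$. It is *dominant energy nice on* $K$ if it is both weak and semi-dominant energy nice on $K$. For a semi-Riemannian metric $\bar g$ and $\Lambda\in\mathbb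 R$ let $T=\mathrm{Ric}_{\bar g}-\tfrac12\mathrm{scal}_{\bar g}\,\bar g+\Lambda\bar g$. On $K$, $\bar g$ satisfies the *strict weak energy condition* with respect to $\Lambda$ if $T(v,v)>0$ for every $\bar g$-causal $v\in T_xM$, $x\in K$; the *strict semi-dominant energy condition* if $-\sharp_{\bar g}(T(v,\cdot))$ is $\bar g$-timelike for every such $v$; the *strict dominant energy condition* if both hold; and the *strict causal convergence condition* if $\mathrm{Ric}_{\bar g}(v,v)>0$ for every such $v$, lightlike or timelike. **Proposition 6.3.** Let $(M,g)$ be a semi-Riemannian manifold, $H$ a space distribution on $M$, $V$ its $g$-orthogonal complement, $K\subseteq M$ compact, and $\Lambda\in\mathbb R$. If $(M,g,H)$ is (a) weak energy nice, (b) semi-dominant energy nice, (c) dominant energy nice, (d) causal convergence nice on $K$, respectively, then there exists $\varepsilon_0>0$ such that for all $\varepsilon\in(0,\varepsilon_0]$ the metric $\mathrm{stretch}(g,\varepsilon,V)$ satisfies on $K$ the (a) strict weak energy condition with respect to $\Lambda$, (b) strict semi-dominant energy condition with respect to $\Lambda$, (c) strict dominant energy condition with respect to $\Lambda$, (d) strict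 causal convergence condition, respectively. -/

import Mathlib

open Set
open scoped Manifold ContDiff Topology

noncomputable section

/-! ## Linear algebra of a scalar product `g` on a real vector space -/

namespace SemiRiem

section LinearAlgebra

variable {E : Type*} [AddCommGroup E] [Module ℝ E]

/-- `v` is timelike: `g(v,v) < 0`. -/
def IsTimelike (g : LinearMap.BilinForm ℝ E) (v : E) : Prop := g v v < 0

/-- `v` is lightlike: `g(v,v) = 0` and `v ≠ 0`. -/
def IsLightlike (g : LinearMap.BilinForm ℝ E) (v : E) : Prop := g v v = 0 ∧ v ≠ 0

/-- `v` is causal: timelike or lightlike. -/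
def IsCausal (g : LinearMap.BilinForm ℝ E) (v : E) : Prop := IsTimelike g v ∨ IsLightlike g v

/-- `v` is spacelike: `g(v,v) > 0` (in particular `v ≠ 0`). -/
def IsSpacelike (g : LinearMap.BilinForm ℝ E) (v : E) : Prop := 0 < g v v

/-- `q` is the index of `g`: the largest dimension of a subspace on which `g` is negative
definite. -/
def HasIndex (g : LinearMap.BilinForm ℝ E) (q : ℕ) : Prop :=
  IsGreatest {k : ℕ | ∃ W : Submodule ℝ E, Module.finrank ℝ W = k ∧
    ∀ w ∈ W, w ≠ 0 → IsTimelike g w} q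

/-- The `g`-orthogonal space `{v | ∀ w ∈ U, g(v,w) = 0}` of `U`. -/
def perp (g : LinearMap.BilinForm ℝ E) (U : Submodule ℝ E) : Submodule ℝ E where
  carrier := {v | ∀ w ∈ U, g v w = 0}
  add_mem' := fun ha hb w hw => by simp [ha w hw, hb w hw]
  zero_mem' := fun w _ => by simp
  smul_mem' := fun c v hv w hw => by simp [hv w hw]

open Classical in
/-- The `g`-orthogonal projection `E → U ⊆ E`, i.e. the projection onto `U` along `perp g U`
(by convention `0` when these two spaces are not complementary). -/
def proj (g : LinearMap.BilinForm ℝ E) (U : Submodule ℝ E) : E →ₗ[ℝ] E :=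
  if h : IsCompl U (perp g U) then U.projection (perp g U) h else 0

open Classical in
/-- The isomorphism `♯ : E* → E` given by `g`: `♯α` is the vector `w` with `g(w,z) = α(z)` for all
`z`; it exists and is unique when `g` is nondegenerate and `α` is linear (by convention `♯α = 0` if
there is no such vector). -/
def sharp (g : LinearMap.BilinForm ℝ E) (α : E → ℝ) : E :=
  if h : ∃ w : E, ∀ z : E, g w z = α z then h.choose else 0

/-- `e` is a `g`-orthonormal basis of the subspace `U`. -/
def IsOrthonormalBasisOf (g : LinearMap.BilinForm ℝ E) (U : Submodule ℝ E)
    (e : Fin (Module.finrank ℝ U) → E) : Prop :=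
  (∀ i j, i ≠ j → g (e i) (e j) = 0) ∧ (∀ i, g (e i) (e i) = 1 ∨ g (e i) (e i) = -1) ∧
    LinearIndependent ℝ e ∧ Submodule.span ℝ (range e) = U

open Classical in
/-- The trace of a bilinear `B` over the subspace `U` with respect to `g`:
`∑ ε_ν B(e_ν,e_ν)` with `ε_ν = g(e_ν,e_ν)`, for a `g`-orthonormal basis `e` of `U`. Such a basis
exists when `g` is symmetric and nondegenerate on the finite-dimensional space `U`, and the sum does
not depend on its choice when `B` is bilinear. -/
def traceOn (g : LinearMap.BilinForm ℝ E) (U : Submodule ℝ E) (B : E → E → ℝ) : ℝ :=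
  if h : ∃ e : Fin (Module.finrank ℝ U) → E, IsOrthonormalBasisOf g U e then
    ∑ i, g (h.choose i) (h.choose i) * B (h.choose i) (h.choose i)
  else 0

end LinearAlgebra

/-! ## Semi-Riemannian metrics, distributions, stretching -/

section Manifold

variable {n : ℕ} {M : Type*} [TopologicalSpace M] [ChartedSpace (EuclideanSpace ℝ (Fin n)) M]

variable (n M) in
/-- Vector fields on the `n`-manifold `M` (without any regularity). -/
abbrev VField : Type _ := Π x : M, TangentSpace (𝓡 n) x

variable (n M) in
/-- Fields of bilinear forms on the tangent spaces of `M` (without any regularity). -/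
abbrev BilinField : Type _ := Π x : M, LinearMap.BilinForm ℝ (TangentSpace (𝓡 n) x)

variable (n M) in
/-- Fields of subspaces of the tangent spaces of `M` (without any regularity). -/
abbrev SubspaceField : Type _ := Π x : M, Submodule ℝ (TangentSpace (𝓡 n) x)

variable [IsManifold (𝓡 n) ∞ M]

/-- `X` is a smooth vector field on the set `s`. -/
def SmoothVFieldOn (X : VField n M) (s : Set M) : Prop :=
  ContMDiffOn (𝓡 n) (𝓡 n).tangent ∞ (fun y => (⟨y, X y⟩ : TangentBundle (𝓡 n) M)) s

/-- `H` is a smooth `p`-plane distribution: near every point there are `p` smooth vector fields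
which form a basis of the fibre `H_y` at each nearby `y`. -/
def IsDistribution (p : ℕ) (H : SubspaceField n M) : Prop :=
  ∀ x : M, ∃ U ∈ 𝓝 x, ∃ s : Fin p → VField n M, (∀ i, SmoothVFieldOn (s i) U) ∧
    ∀ y ∈ U, LinearIndependent ℝ (fun i => s i y) ∧
      Submodule.span ℝ (range fun i => s i y) = H y

/-- The `g`-orthogonal distribution `⊥_g U` of `U`. -/
def orthDistr (g : BilinField n M) (U : SubspaceField n M) : SubspaceField n M :=
  fun x => perp (g x) (U x)

/-- `H` is a space distribution for the metric `g` of index `q` on the `n`-manifold `M`: a smooth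
`(n-q)`-plane distribution all of whose nonzero vectors are spacelike. -/
def IsSpaceDistribution (g : BilinField n M) (q : ℕ) (H : SubspaceField n M) : Prop :=
  IsDistribution (n - q) H ∧ ∀ x, ∀ v ∈ H x, v ≠ 0 → IsSpacelike (g x) v

/-- The positive form `g_V = -g` on `V`, extended by `0` to the `g`-orthogonal complement of `V`,
i.e. `(u,v) ↦ -g(u_V,v_V)`. -/
def gV (g : BilinField n M) (V : SubspaceField n M) : BilinField n M :=
  fun x => -(g x).compl₁₂ (proj (g x) (V x)) (proj (g x) (V x))

/-- The form `g_H = g` on the `g`-orthogonal complement `H` of `V`, extended by `0` to `V`, i.e.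
`(u,v) ↦ g(u_H,v_H)` with `u_H = u - u_V`. -/
def gH (g : BilinField n M) (V : SubspaceField n M) : BilinField n M :=
  fun x => (g x).compl₁₂ (LinearMap.id - proj (g x) (V x)) (LinearMap.id - proj (g x) (V x))

/-- `switch(g,V) = g_V ⊕ g_H`. -/
def switch (g : BilinField n M) (V : SubspaceField n M) : BilinField n M :=
  fun x => gV g V x + gH g V x

/-- `stretch(g,f,V) = (-(1/f²) g_V) ⊕ g_H`. -/
def stretch (g : BilinField n M) (f : M → ℝ) (V : SubspaceField n M) : BilinField n M :=
  fun x => -(1 / f x ^ 2) • gV g V x + gH g V x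

/-- `g` is a (smooth) semi-Riemannian metric of index `q` on `M`. -/
structure IsSemiRiemannianMetric (g : BilinField n M) (q : ℕ) : Prop where
  symm : ∀ (x : M) (v w : TangentSpace (𝓡 n) x), g x v w = g x w v
  nondeg : ∀ (x : M) (v : TangentSpace (𝓡 n) x), (∀ w, g x v w = 0) → v = 0
  index : ∀ x : M, HasIndex (g x) q
  smooth : ∃ G : Π x : M, TangentSpace (𝓡 n) x →L[ℝ] TangentSpace (𝓡 n) x →L[ℝ] ℝ,
    ContMDiff (𝓡 n) ((𝓡 n).prod
        𝓘(ℝ, EuclideanSpace ℝ (Fin n) →L[ℝ] EuclideanSpace ℝ (Fin n) →L[ℝ] ℝ)) ∞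
      (fun x => Bundle.TotalSpace.mk'
        (EuclideanSpace ℝ (Fin n) →L[ℝ] EuclideanSpace ℝ (Fin n) →L[ℝ] ℝ) x (G x)) ∧
    ∀ (x : M) (v w : TangentSpace (𝓡 n) x), g x v w = G x v w

/-- A vector field with value `v` at `x`, smooth near `x` (constant components in the preferred
chart at `x`). -/
def extendTangent {x : M} (v : TangentSpace (𝓡 n) x) : VField n M :=
  FiberBundle.extend (EuclideanSpace ℝ (Fin n)) v

/-! ## The Levi-Civita connection and curvature -/

/-- The right-hand side of the Koszul formula, i.e. `2 g(∇_X Y, Z)`. -/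
def koszul (g : BilinField n M) (X Y Z : VField n M) (x : M) : ℝ :=
  mvfderiv (𝓡 n) (fun y => g y (Y y) (Z y)) x (X x)
    + mvfderiv (𝓡 n) (fun y => g y (X y) (Z y)) x (Y x)
    - mvfderiv (𝓡 n) (fun y => g y (X y) (Y y)) x (Z x)
    + g x (VectorField.mlieBracket (𝓡 n) X Y x) (Z x)
    - g x (VectorField.mlieBracket (𝓡 n) X Z x) (Y x)
    - g x (VectorField.mlieBracket (𝓡 n) Y Z x) (X x)

/-- The Levi-Civita connection `∇_X Y` of `g`, defined through the Koszul formula. -/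
def nabla (g : BilinField n M) (X Y : VField n M) : VField n M :=
  fun x => sharp (g x) (fun z => koszul g X Y (extendTangent z) x / 2)

/-- The Riemann curvature `R(u,v)w = ∇_X ∇_Y Z - ∇_Y ∇_X Z - ∇_[X,Y] Z` at `x`, where `X,Y,Z` are
local extensions of `u,v,w`. -/
def riem (g : BilinField n M) (x : M) (u v w : TangentSpace (𝓡 n) x) : TangentSpace (𝓡 n) x :=
  nabla g (extendTangent u) (nabla g (extendTangent v) (extendTangent w)) x
    - nabla g (extendTangent v) (nabla g (extendTangent u) (extendTangent w)) x
    - nabla g (VectorField.mlieBracket (𝓡 n) (extendTangent u) (extendTangent v)) (extendTangent w) x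

/-- The Ricci tensor `Ric(v,w) = ∑ ε_i g(R(e_i,v)w, e_i)`. -/
def ric (g : BilinField n M) (x : M) (v w : TangentSpace (𝓡 n) x) : ℝ :=
  traceOn (g x) ⊤ (fun a b => g x (riem g x a v w) b)

/-- The scalar curvature `∑ ε_i Ric(e_i,e_i)`. -/
def scal (g : BilinField n M) (x : M) : ℝ := traceOn (g x) ⊤ (ric g x)

/-- The energy-momentum tensor `T = Ric - (1/2) scal g + Λ g`. -/
def energyMomentum (g : BilinField n M) (Λ : ℝ) (x : M) (v w : TangentSpace (𝓡 n) x) : ℝ :=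
  ric g x v w - 1 / 2 * scal g x * g x v w + Λ * g x v w

/-! ## Energy and convergence conditions on a set `K` -/

/-- `T(v,v) > 0` for all causal `v` over `K`. -/
def StrictWeakEnergyOn (g : BilinField n M) (Λ : ℝ) (K : Set M) : Prop :=
  ∀ x ∈ K, ∀ v : TangentSpace (𝓡 n) x, IsCausal (g x) v → 0 < energyMomentum g Λ x v v

/-- `-♯(T(v,·))` is timelike for all causal `v` over `K`. -/
def StrictSemiDominantEnergyOn (g : BilinField n M) (Λ : ℝ) (K : Set M) : Prop :=
  ∀ x ∈ K, ∀ v : TangentSpace (𝓡 n) x, IsCausal (g x) v →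
    IsTimelike (g x) (-sharp (g x) (energyMomentum g Λ x v))

def StrictDominantEnergyOn (g : BilinField n M) (Λ : ℝ) (K : Set M) : Prop :=
  StrictWeakEnergyOn g Λ K ∧ StrictSemiDominantEnergyOn g Λ K

def StrictLightlikeConvergenceOn (g : BilinField n M) (K : Set M) : Prop :=
  ∀ x ∈ K, ∀ v : TangentSpace (𝓡 n) x, IsLightlike (g x) v → 0 < ric g x v v

def StrictTimelikeConvergenceOn (g : BilinField n M) (K : Set M) : Prop :=
  ∀ x ∈ K, ∀ v : TangentSpace (𝓡 n) x, IsTimelike (g x) v → 0 < ric g x v v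

def StrictCausalConvergenceOn (g : BilinField n M) (K : Set M) : Prop :=
  StrictLightlikeConvergenceOn g K ∧ StrictTimelikeConvergenceOn g K

/-! ## Twistedness and niceness -/

/-- A section of `H`, smooth near `x`, with value `u_H` at `x` (hence `u`, if `u ∈ H_x`). -/
def extendIn (g : BilinField n M) (H : SubspaceField n M) {x : M} (u : TangentSpace (𝓡 n) x) :
    VField n M :=
  fun y => proj (g y) (H y) (extendTangent u y)

/-- The twistedness `Tw_{g,H}(u,v,w) = g([û,v̂],w)` for `u,v ∈ H_x` and `w` in the orthogonal
complement of `H_x`, where `û,v̂` are sections of `H` with values `u,v` at `x`. -/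
def tw (g : BilinField n M) (H : SubspaceField n M) (x : M) (u v w : TangentSpace (𝓡 n) x) : ℝ :=
  g x (VectorField.mlieBracket (𝓡 n) (extendIn g H u) (extendIn g H v) x) w

/-- The symmetric bilinear form `b_{g,H}`. With `V` the orthogonal complement of `H`, it is
`-2 tr_H^a tr_V^b Tw(v,a,b) Tw(w,a,b)` on `H`, it is `tr_H^a tr_H^b Tw(a,b,v) Tw(a,b,w)` on `V`, and
`V` and `H` are `b`-orthogonal. -/
def bForm (g : BilinField n M) (H : SubspaceField n M) (x : M) (v w : TangentSpace (𝓡 n) x) : ℝ :=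
  -2 * traceOn (g x) (H x) (fun a a' => traceOn (g x) (orthDistr g H x) (fun b b' =>
      tw g H x (proj (g x) (H x) v) a b * tw g H x (proj (g x) (H x) w) a' b'))
    + traceOn (g x) (H x) (fun a a' => traceOn (g x) (H x) (fun b b' =>
      tw g H x a b (proj (g x) (orthDistr g H x) v)
        * tw g H x a' b' (proj (g x) (orthDistr g H x) w)))

/-- `β_{g,H} = b_{g,H} - (1/2) tr_g(b_{g,H}) g`. -/
def betaForm (g : BilinField n M) (H : SubspaceField n M) (x : M)
    (v w : TangentSpace (𝓡 n) x) : ℝ :=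
  bForm g H x v w - 1 / 2 * traceOn (g x) ⊤ (bForm g H x) * g x v w

/-- The norm `|v|_h` of the Riemannian metric `h = switch(g,V)`, `V` the orthogonal complement
of `H`. -/
def hNorm (g : BilinField n M) (H : SubspaceField n M) (x : M) (v : TangentSpace (𝓡 n) x) : ℝ :=
  Real.sqrt (switch g (orthDistr g H) x v v)

def WeakEnergyNiceOn (g : BilinField n M) (H : SubspaceField n M) (K : Set M) : Prop :=
  ∃ c : ℝ, 0 < c ∧ ∀ x ∈ K, ∀ v : TangentSpace (𝓡 n) x, IsCausal (g x) v → 1 ≤ hNorm g H x v →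
    c ≤ betaForm g H x v v

def SemiDominantEnergyNiceOn (g : BilinField n M) (H : SubspaceField n M) (K : Set M) : Prop :=
  ∃ c : ℝ, 0 < c ∧ ∀ x ∈ K, ∀ v : TangentSpace (𝓡 n) x, IsCausal (g x) v → 1 ≤ hNorm g H x v →
    c ≤ -g x (sharp (g x) (betaForm g H x v)) (sharp (g x) (betaForm g H x v))

def DominantEnergyNiceOn (g : BilinField n M) (H : SubspaceField n M) (K : Set M) : Prop :=
  WeakEnergyNiceOn g H K ∧ SemiDominantEnergyNiceOn g H K

def CausalConvergenceNiceOn (g : BilinField n M) (H : SubspaceField n M) (K : Set M) : Prop :=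
  ∃ c : ℝ, 0 < c ∧ ∀ x ∈ K, ∀ v : TangentSpace (𝓡 n) x, IsCausal (g x) v → 1 ≤ hNorm g H x v →
    c ≤ bForm g H x v v

end Manifold

end SemiRiem

end

/-! Take a local `g`-orthonormal frame adapted to `TM = H ⊕ V` and multiply its vertical members by
`ε`. The result is orthonormal for the stretched metric, with the same signs. With weight `w = 0` on
horizontal and `w = 1` on vertical indices, its structure coefficients are `ε^(w_i + w_j - w_k)
C_ij^k`. The only negative power is `ε⁻¹`, and it sits on the vertical part of the bracket of two
horizontal fields, that is, on the twistedness.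

The Ricci components in an orthonormal frame are built from products of two structure coefficients
and from first derivatives of single ones. So `ε² Ric` is a polynomial in `ε`
(`mul_ricCoef_stretch`). The derivative terms keep a spare factor `ε`, hence the constant term is
quadratic in the twistedness alone, and it equals `b / 4` (`ricPoly_zero`). Consequently `ε² T` has
limit `β / 4`, the cosmological term contributing only `ε² Λ`.

In orthonormal coordinates the causal cone is `∑ s_i w_i² ≤ 0` for every `ε` (`isCausal_iff`).
Niceness bounds the limit function below by a positive constant on the unit vectors of this cone.
Continuity in `ε`, in the point and in the vector, compactness of the unit sphere and of `K`, and
homogeneity then give positivity for all small `ε` (`eventually_pos_of_homogeneous`,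
`exists_uniform`, `exists_stretch_of_limit`).

Connection, curvature, twistedness and `b` are defined through particular local extensions and
particular bases. The frame formulas `frameCoord_nabla`, `frameCoord_riem`, `ric_eq`, `tw_apply` and
`bForm_eq` show that these choices do not matter. -/

noncomputable section

namespace SemiRiem

/-! ### Smooth functions, vector fields and Lie brackets near a point -/

section FrameCalculus

variable {n : ℕ} {M : Type*} [TopologicalSpace M] [ChartedSpace (EuclideanSpace ℝ (Fin n)) M]

/-- `f` is a smooth function on a neighbourhood of `x`. -/
def SmoothFunAt (n : ℕ) [ChartedSpace (EuclideanSpace ℝ (Fin n)) M] (f : M → ℝ) (x : M) : Prop :=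
  ∀ᶠ y in 𝓝 x, ContMDiffAt (𝓡 n) 𝓘(ℝ, ℝ) ∞ f y

/-- The derivative of the function `f` in direction of the vector field `X`. -/
def dirDeriv (X : VField n M) (f : M → ℝ) (x : M) : ℝ := mvfderiv (𝓡 n) f x (X x)

lemma SmoothFunAt.contMDiffAt {f : M → ℝ} {x : M} (h : SmoothFunAt n f x) :
    ContMDiffAt (𝓡 n) 𝓘(ℝ, ℝ) ∞ f x := h.self_of_nhds

lemma SmoothFunAt.mdiff {f : M → ℝ} {x : M} (h : SmoothFunAt n f x) :
    MDifferentiableAt (𝓡 n) 𝓘(ℝ, ℝ) f x :=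
  h.contMDiffAt.mdifferentiableAt (by simp)

lemma SmoothFunAt.continuousAt {f : M → ℝ} {x : M} (h : SmoothFunAt n f x) :
    ContinuousAt f x := h.contMDiffAt.continuousAt

lemma SmoothFunAt.eventually {f : M → ℝ} {x : M} (h : SmoothFunAt n f x) :
    ∀ᶠ y in 𝓝 x, SmoothFunAt n f y := eventually_eventually_nhds.2 h

lemma SmoothFunAt.congr {f f' : M → ℝ} {x : M} (h : SmoothFunAt n f x)
    (hf : f' =ᶠ[𝓝 x] f) : SmoothFunAt n f' x := by
  filter_upwards [h, hf.eventuallyEq_nhds] with y h1 h2 using h1.congr_of_eventuallyEq h2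

lemma smoothFunAt_const (c : ℝ) (x : M) : SmoothFunAt n (fun _ : M => c) x :=
  Filter.Eventually.of_forall fun _ => contMDiffAt_const

lemma SmoothFunAt.add {f f' : M → ℝ} {x : M} (h : SmoothFunAt n f x)
    (h' : SmoothFunAt n f' x) : SmoothFunAt n (fun y => f y + f' y) x := by
  filter_upwards [h, h'] with y h1 h2 using h1.add h2

lemma SmoothFunAt.sub {f f' : M → ℝ} {x : M} (h : SmoothFunAt n f x)
    (h' : SmoothFunAt n f' x) : SmoothFunAt n (fun y => f y - f' y) x := by
  filter_upwards [h, h'] with y h1 h2 using h1.sub h2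

lemma SmoothFunAt.mul {f f' : M → ℝ} {x : M} (h : SmoothFunAt n f x)
    (h' : SmoothFunAt n f' x) : SmoothFunAt n (fun y => f y * f' y) x := by
  filter_upwards [h, h'] with y h1 h2 using h1.mul h2

lemma SmoothFunAt.const_mul {f : M → ℝ} {x : M} (c : ℝ) (h : SmoothFunAt n f x) :
    SmoothFunAt n (fun y => c * f y) x := (smoothFunAt_const c x).mul h

lemma SmoothFunAt.sum {ι : Type*} {t : Finset ι} {f : ι → M → ℝ} {x : M}
    (h : ∀ i ∈ t, SmoothFunAt n (f i) x) : SmoothFunAt n (fun y => ∑ i ∈ t, f i y) x := by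
  filter_upwards [(Filter.eventually_all_finset t).2 h] with y h1 using contMDiffAt_finsetSum h1

lemma dirDeriv_congr {X X' : VField n M} {f f' : M → ℝ} {x : M} (hf : f =ᶠ[𝓝 x] f')
    (hX : X x = X' x) : dirDeriv X f x = dirDeriv X' f' x := by
  simp only [dirDeriv, hX, mvfderiv, ContinuousLinearMap.comp_apply]
  rw [hf.mfderiv_eq, hf.self_of_nhds]

lemma dirDeriv_const (X : VField n M) (c : ℝ) (x : M) : dirDeriv X (fun _ => c) x = 0 := by
  simp [dirDeriv, mvfderiv_const]

lemma dirDeriv_add {X : VField n M} {f f' : M → ℝ} {x : M} (hf : SmoothFunAt n f x)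
    (hf' : SmoothFunAt n f' x) :
    dirDeriv X (fun y => f y + f' y) x = dirDeriv X f x + dirDeriv X f' x := by
  simp only [dirDeriv]
  rw [mvfderiv_fun_add hf.mdiff hf'.mdiff]; rfl

lemma dirDeriv_mul {X : VField n M} {f f' : M → ℝ} {x : M} (hf : SmoothFunAt n f x)
    (hf' : SmoothFunAt n f' x) :
    dirDeriv X (fun y => f y * f' y) x = f x * dirDeriv X f' x + dirDeriv X f x * f' x := by
  simp only [dirDeriv]
  rw [mvfderiv_fun_mul hf.mdiff hf'.mdiff, mul_comm (mvfderiv (𝓡 n) f x (X x))]; rfl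

lemma dirDeriv_const_mul {X : VField n M} {f : M → ℝ} {x : M} (c : ℝ) (hf : SmoothFunAt n f x) :
    dirDeriv X (fun y => c * f y) x = c * dirDeriv X f x := by
  rw [dirDeriv_mul (smoothFunAt_const c x) hf, dirDeriv_const]; ring

lemma dirDeriv_sum {ι : Type*} {t : Finset ι} {X : VField n M} {f : ι → M → ℝ} {x : M}
    (hf : ∀ i, SmoothFunAt n (f i) x) :
    dirDeriv X (fun y => ∑ i ∈ t, f i y) x = ∑ i ∈ t, dirDeriv X (f i) x := by
  classical
  induction t using Finset.induction_on with
  | empty => simp [dirDeriv_const]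
  | insert a t ha ih =>
    simp only [Finset.sum_insert ha]
    rw [dirDeriv_add (hf a) (SmoothFunAt.sum fun i _ => hf i), ih]

lemma dirDeriv_sum_smul_left {ι : Type*} {t : Finset ι} {a : ι → M → ℝ} {X : ι → VField n M}
    {f : M → ℝ} {x : M} :
    dirDeriv (fun y => ∑ i ∈ t, a i y • X i y) f x = ∑ i ∈ t, a i x * dirDeriv (X i) f x := by
  simp only [dirDeriv]
  rw [map_sum]
  exact Finset.sum_congr rfl fun i _ => by rw [map_smul]; rfl

lemma dirDeriv_smul_left {a : M → ℝ} {X : VField n M} {f : M → ℝ} {x : M} :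
    dirDeriv (fun y => a y • X y) f x = a x * dirDeriv X f x := by
  simp only [dirDeriv]
  rw [map_smul]; rfl

variable [IsManifold (𝓡 n) ∞ M]

/-- `X` is a smooth vector field on a neighbourhood of `x`. -/
def SmoothVFieldAt (X : VField n M) (x : M) : Prop :=
  ∀ᶠ y in 𝓝 x, ContMDiffAt (𝓡 n) (𝓡 n).tangent ∞ (fun y => (⟨y, X y⟩ : TangentBundle (𝓡 n) M)) y

lemma SmoothVFieldAt.contMDiffAt {X : VField n M} {x : M} (h : SmoothVFieldAt X x) :
    ContMDiffAt (𝓡 n) (𝓡 n).tangent ∞ (fun y => (⟨y, X y⟩ : TangentBundle (𝓡 n) M)) x :=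
  h.self_of_nhds

lemma SmoothVFieldAt.mdiff {X : VField n M} {x : M} (h : SmoothVFieldAt X x) :
    MDifferentiableAt (𝓡 n) (𝓡 n).tangent (fun y => (⟨y, X y⟩ : TangentBundle (𝓡 n) M)) x :=
  ContMDiffAt.mdifferentiableAt h.contMDiffAt (by simp)

lemma SmoothVFieldAt.eventually {X : VField n M} {x : M} (h : SmoothVFieldAt X x) :
    ∀ᶠ y in 𝓝 x, SmoothVFieldAt X y := eventually_eventually_nhds.2 h

lemma SmoothVFieldAt.congr {X X' : VField n M} {x : M} (h : SmoothVFieldAt X x)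
    (hX : ∀ᶠ y in 𝓝 x, X' y = X y) : SmoothVFieldAt X' x := by
  filter_upwards [h, eventually_eventually_nhds.2 hX] with y h1 h2
  refine h1.congr_of_eventuallyEq ?_
  filter_upwards [h2] with z hz
  rw [hz]

lemma SmoothVFieldAt.bracket {X Y : VField n M} {x : M} (hX : SmoothVFieldAt X x)
    (hY : SmoothVFieldAt Y x) : SmoothVFieldAt (VectorField.mlieBracket (𝓡 n) X Y) x := by
  have : IsManifold (𝓡 n) (((⊤ : ℕ∞) : WithTop ℕ∞) + 1) M := by
    simpa using (inferInstance : IsManifold (𝓡 n) ∞ M)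
  have : IsManifold (𝓡 n) (minSmoothness ℝ 2) M := by
    simpa using (inferInstance : IsManifold (𝓡 n) 2 M)
  have : IsManifold (𝓡 n) (minSmoothness ℝ 3) M := by
    simpa using (inferInstance : IsManifold (𝓡 n) 3 M)
  filter_upwards [hX, hY] with y h1 h2
  exact ContMDiffAt.mlieBracket_vectorField (m := ⊤) (n := ⊤) h1 h2 (by simp)

lemma smoothVFieldAt_extendTangent {x : M} (v : TangentSpace (𝓡 n) x) :
    SmoothVFieldAt (extendTangent v) x := by
  obtain ⟨t, ht, h⟩ :=
    FiberBundle.exists_contMDiffOn_extend (k := ∞) (𝓡 n) (EuclideanSpace ℝ (Fin n)) v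
  filter_upwards [eventually_mem_nhds_iff.2 ht] with y hy using h.contMDiffAt hy

lemma extendTangent_self {x : M} (v : TangentSpace (𝓡 n) x) : extendTangent v x = v := by
  simp [extendTangent]

lemma SmoothVFieldAt.smul {f : M → ℝ} {X : VField n M} {x : M} (hf : SmoothFunAt n f x)
    (hX : SmoothVFieldAt X x) : SmoothVFieldAt (fun y => f y • X y) x := by
  filter_upwards [hf, hX] with y h1 h2 using ContMDiffAt.smul_section h1 h2

lemma SmoothVFieldAt.sum {ι : Type*} {t : Finset ι} {X : ι → VField n M} {x : M}
    (hX : ∀ i ∈ t, SmoothVFieldAt (X i) x) : SmoothVFieldAt (fun y => ∑ i ∈ t, X i y) x := by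
  filter_upwards [(Filter.eventually_all_finset t).2 hX] with y h1 using ContMDiffAt.sum_section h1

lemma SmoothVFieldAt.sub {X Y : VField n M} {x : M} (hX : SmoothVFieldAt X x)
    (hY : SmoothVFieldAt Y x) : SmoothVFieldAt (fun y => X y - Y y) x := by
  filter_upwards [hX, hY] with y h1 h2 using ContMDiffAt.sub_section h1 h2

omit [IsManifold (𝓡 n) ∞ M] in
lemma mlieBracket_congr {X X' Y Y' : VField n M} {x : M} (hX : ∀ᶠ y in 𝓝 x, X y = X' y)
    (hY : ∀ᶠ y in 𝓝 x, Y y = Y' y) :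
    VectorField.mlieBracket (𝓡 n) X Y x = VectorField.mlieBracket (𝓡 n) X' Y' x :=
  Filter.EventuallyEq.mlieBracket_vectorField_eq hX hY

lemma mlieBracket_smul_right' {X Y : VField n M} {f : M → ℝ} {x : M} (hf : SmoothFunAt n f x)
    (hY : SmoothVFieldAt Y x) :
    VectorField.mlieBracket (𝓡 n) X (fun y => f y • Y y) x
      = dirDeriv X f x • Y x + f x • VectorField.mlieBracket (𝓡 n) X Y x :=
  VectorField.mlieBracket_smul_right hf.mdiff hY.mdiff

lemma mlieBracket_sum_smul {ι : Type*} {t : Finset ι} {X : VField n M} {f : ι → M → ℝ}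
    {E : ι → VField n M} {x : M} (hf : ∀ i, SmoothFunAt n (f i) x)
    (hE : ∀ i, SmoothVFieldAt (E i) x) :
    VectorField.mlieBracket (𝓡 n) X (fun y => ∑ i ∈ t, f i y • E i y) x
      = ∑ i ∈ t, (dirDeriv X (f i) x • E i x
          + f i x • VectorField.mlieBracket (𝓡 n) X (E i) x) := by
  classical
  induction t using Finset.induction_on with
  | empty =>
    simp only [Finset.sum_empty]
    exact congrFun (VectorField.mlieBracket_zero_right (I := 𝓡 n) (W := X)) x
  | insert a t ha ih =>
    simp only [Finset.sum_insert ha]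
    rw [← ih, ← mlieBracket_smul_right' (hf a) (hE a)]
    exact VectorField.mlieBracket_add_right (SmoothVFieldAt.smul (hf a) (hE a)).mdiff
      (SmoothVFieldAt.sum fun i _ => SmoothVFieldAt.smul (hf i) (hE i)).mdiff

/-- Lie brackets act on functions as commutators of derivations. -/
lemma dirDeriv_commutator {X Y Z : VField n M} {f : M → ℝ} {x : M} (hX : SmoothVFieldAt X x)
    (hY : SmoothVFieldAt Y x) (hZ : SmoothVFieldAt Z x) (hZ0 : Z x ≠ 0) (hf : SmoothFunAt n f x)
    (hXf : SmoothFunAt n (dirDeriv X f) x) (hYf : SmoothFunAt n (dirDeriv Y f) x) :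
    dirDeriv X (dirDeriv Y f) x - dirDeriv Y (dirDeriv X f) x
      = dirDeriv (VectorField.mlieBracket (𝓡 n) X Y) f x := by
  have : IsManifold (𝓡 n) (minSmoothness ℝ 3) M := by
    simpa using (inferInstance : IsManifold (𝓡 n) 3 M)
  have two : ∀ {W : VField n M}, SmoothVFieldAt W x →
      ContMDiffAt (𝓡 n) (𝓡 n).tangent (minSmoothness ℝ 2)
        (fun y => (⟨y, W y⟩ : TangentBundle (𝓡 n) M)) x := fun h =>
    h.contMDiffAt.of_le (by simpa using
      (WithTop.coe_le_coe.2 le_top : ((2 : ℕ∞) : WithTop ℕ∞) ≤ ((⊤ : ℕ∞) : WithTop ℕ∞)))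
  -- Apply the Jacobi identity to `X`, `Y`, `fZ` and expand by the Leibniz rule. After the identity
  -- for `X`, `Y`, `Z` is used, what remains is a multiple of `Z x`; its coefficient must vanish
  -- because `Z x ≠ 0`.
  have key := VectorField.leibniz_identity_mlieBracket_apply (two hX) (two hY)
    (two (SmoothVFieldAt.smul hf hZ))
  have e1 : ∀ {W : VField n M}, VectorField.mlieBracket (𝓡 n) W (fun y => f y • Z y)
      =ᶠ[𝓝 x] fun y => dirDeriv W f y • Z y + f y • VectorField.mlieBracket (𝓡 n) W Z y := by
    intro W
    filter_upwards [hf.eventually, hZ.eventually] with y h1 h2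
    exact mlieBracket_smul_right' h1 h2
  have add2 : ∀ {W A : VField n M} {a : M → ℝ}, SmoothFunAt n a x → SmoothVFieldAt A x →
      VectorField.mlieBracket (𝓡 n) W (fun y => a y • Z y + f y • A y) x
      = dirDeriv W a x • Z x + a x • VectorField.mlieBracket (𝓡 n) W Z x
        + (dirDeriv W f x • A x + f x • VectorField.mlieBracket (𝓡 n) W A x) := by
    intro W A a ha hA
    rw [← mlieBracket_smul_right' ha hZ, ← mlieBracket_smul_right' hf hA]
    exact VectorField.mlieBracket_add_right (SmoothVFieldAt.smul ha hZ).mdiff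
      (SmoothVFieldAt.smul hf hA).mdiff
  rw [Filter.EventuallyEq.mlieBracket_vectorField_eq (Filter.EventuallyEq.refl _ X) e1,
    Filter.EventuallyEq.mlieBracket_vectorField_eq (Filter.EventuallyEq.refl _ Y) e1,
    add2 hYf (hY.bracket hZ), add2 hXf (hX.bracket hZ), mlieBracket_smul_right' hf hZ,
    VectorField.leibniz_identity_mlieBracket_apply (two hX) (two hY) (two hZ)] at key
  have h0 : (dirDeriv X (dirDeriv Y f) x - dirDeriv Y (dirDeriv X f) x
      - dirDeriv (VectorField.mlieBracket (𝓡 n) X Y) f x) • Z x = 0 := by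
    rw [smul_add] at key
    rw [sub_smul, sub_smul]
    rw [← sub_eq_zero.2 key]
    abel
  rcases smul_eq_zero.1 h0 with h | h
  · linarith
  · exact absurd h hZ0

end FrameCalculus

section Sharp

variable {E : Type*} [AddCommGroup E] [Module ℝ E]

/-- A solution `w` rules out the default value `0`, and nondegeneracy forces the chosen vector to
coincide with it. -/
lemma sharp_eq {g : LinearMap.BilinForm ℝ E} (hg : ∀ v, (∀ w, g v w = 0) → v = 0) {α : E → ℝ}
    {w : E} (hw : ∀ z, g w z = α z) : sharp g α = w := by
  have h : ∃ w : E, ∀ z : E, g w z = α z := ⟨w, hw⟩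
  rw [sharp, dif_pos h, ← sub_eq_zero]
  refine hg _ fun z => ?_
  rw [map_sub, LinearMap.sub_apply, h.choose_spec, hw, sub_self]

end Sharp

/-! ### Orthonormal frames and their structure coefficients -/

section OrthoFrame

variable {n : ℕ} {M : Type*} [TopologicalSpace M] [ChartedSpace (EuclideanSpace ℝ (Fin n)) M]
  {ι : Type*} [Fintype ι] [DecidableEq ι]

/-- The `k`-th coordinate `s_k g(v, E_k)` of the tangent vector `v` in the orthonormal frame `E`
with signs `s`. -/
def frameCoord (g : BilinField n M) (s : ι → ℝ) (E : ι → VField n M) (k : ι) (x : M) :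
    TangentSpace (𝓡 n) x →ₗ[ℝ] ℝ := s k • (g x).flip (E k x)

omit [Fintype ι] [DecidableEq ι] in
lemma frameCoord_apply (g : BilinField n M) (s : ι → ℝ) (E : ι → VField n M) (k : ι) (x : M)
    (v : TangentSpace (𝓡 n) x) : frameCoord g s E k x v = s k * g x v (E k x) := rfl

variable [IsManifold (𝓡 n) ∞ M]

/-- `E` is a smooth `g`-orthonormal frame with signs `s` on the open set `U`, whose coordinate
functions preserve smoothness. -/
structure IsOrthoFrame (g : BilinField n M) (s : ι → ℝ) (E : ι → VField n M) (U : Set M) :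
    Prop where
  isOpen : IsOpen U
  sign : ∀ i, s i = 1 ∨ s i = -1
  smooth : ∀ x ∈ U, ∀ i, SmoothVFieldAt (E i) x
  ortho : ∀ x ∈ U, ∀ i j, g x (E i x) (E j x) = if i = j then s i else 0
  span : ∀ x ∈ U, ∀ v : TangentSpace (𝓡 n) x, ∑ k, frameCoord g s E k x v • E k x = v
  smooth_coord : ∀ x ∈ U, ∀ Z : VField n M, SmoothVFieldAt Z x → ∀ k,
    SmoothFunAt n (fun y => frameCoord g s E k y (Z y)) x

/-- The coefficients of `[E_i, E_j]` in the frame `E`. -/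
def structCoef (g : BilinField n M) (s : ι → ℝ) (E : ι → VField n M) (i j k : ι) (x : M) : ℝ :=
  frameCoord g s E k x (VectorField.mlieBracket (𝓡 n) (E i) (E j) x)

/-- The coefficients of `∇_{E_i} E_j` in the orthonormal frame `E`. -/
def christoffel (g : BilinField n M) (s : ι → ℝ) (E : ι → VField n M) (i j k : ι) (x : M) : ℝ :=
  1 / 2 * (structCoef g s E i j k x - s k * s j * structCoef g s E i k j x
    - s k * s i * structCoef g s E j k i x)

/-- The connection form `ω_j^k(X)` of the orthonormal frame `E`. -/
def connForm (g : BilinField n M) (s : ι → ℝ) (E : ι → VField n M) (X : VField n M) (j k : ι)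
    (x : M) : ℝ :=
  ∑ i, frameCoord g s E i x (X x) * christoffel g s E i j k x

omit [Fintype ι] [DecidableEq ι] [IsManifold (𝓡 n) ∞ M] in
lemma structCoef_swap (g : BilinField n M) (s : ι → ℝ) (E : ι → VField n M) (i j k : ι) (x : M) :
    structCoef g s E j i k x = -structCoef g s E i j k x := by
  rw [structCoef, VectorField.mlieBracket_swap_apply, map_neg, structCoef]

namespace IsOrthoFrame

variable {g : BilinField n M} {s : ι → ℝ} {E : ι → VField n M} {U : Set M}
  (hE : IsOrthoFrame g s E U) {x : M} (hx : x ∈ U)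
include hE

lemma sign_mul_self (i : ι) : s i * s i = 1 := by
  rcases hE.sign i with h | h <;> rw [h] <;> norm_num

include hx

lemma eventually_mem : ∀ᶠ y in 𝓝 x, y ∈ U := hE.isOpen.mem_nhds hx

lemma frameCoord_frame (i k : ι) : frameCoord g s E k x (E i x) = if i = k then 1 else 0 := by
  rw [frameCoord_apply, hE.ortho x hx]
  split_ifs with h
  · rw [h, hE.sign_mul_self]
  · simp

lemma frameCoord_sum (a : ι → ℝ) (k : ι) : frameCoord g s E k x (∑ i, a i • E i x) = a k := by
  rw [map_sum]
  simp [hE.frameCoord_frame hx]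

lemma ext_coord {v w : TangentSpace (𝓡 n) x}
    (h : ∀ k, frameCoord g s E k x v = frameCoord g s E k x w) : v = w := by
  rw [← hE.span x hx v, ← hE.span x hx w]
  exact Finset.sum_congr rfl fun k _ => by rw [h k]

lemma inner_eq (v w : TangentSpace (𝓡 n) x) :
    g x v w = ∑ k, s k * frameCoord g s E k x v * frameCoord g s E k x w := by
  conv_lhs => rw [← hE.span x hx w]
  rw [map_sum]
  refine Finset.sum_congr rfl fun k _ => ?_
  rw [map_smul, smul_eq_mul, mul_comm]
  congr 1
  rw [frameCoord_apply, ← mul_assoc, hE.sign_mul_self, one_mul]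

lemma nondeg (v : TangentSpace (𝓡 n) x) (h : ∀ w, g x v w = 0) : v = 0 := by
  refine hE.ext_coord hx fun k => ?_
  simp [frameCoord_apply, h]

lemma eq_sum (X : VField n M) :
    ∀ᶠ y in 𝓝 x, X y = ∑ k, frameCoord g s E k y (X y) • E k y := by
  filter_upwards [hE.eventually_mem hx] with y hy using (hE.span y hy _).symm

lemma dirDeriv_eq_sum (X : VField n M) (f : M → ℝ) :
    dirDeriv X f x = ∑ k, frameCoord g s E k x (X x) * dirDeriv (E k) f x := by
  refine (dirDeriv_congr (X' := fun y => ∑ k, frameCoord g s E k y (X y) • E k y)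
    (Filter.EventuallyEq.refl _ _) (hE.span x hx _).symm).trans ?_
  exact dirDeriv_sum_smul_left (a := fun k y => frameCoord g s E k y (X y))

lemma smooth_structCoef (i j k : ι) : SmoothFunAt n (structCoef g s E i j k) x :=
  hE.smooth_coord x hx _ ((hE.smooth x hx i).bracket (hE.smooth x hx j)) k

lemma smooth_christoffel (i j k : ι) : SmoothFunAt n (christoffel g s E i j k) x :=
  (((hE.smooth_structCoef hx i j k).sub ((hE.smooth_structCoef hx i k j).const_mul _)).sub
    ((hE.smooth_structCoef hx j k i).const_mul _)).const_mul _

/-- Since `[E_i, f E_i] = (E_i f) E_i`, the function `E_i f` is a coordinate of a smooth field and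
so is smooth. The general `X` is a combination of the `E_i` with smooth coefficients. -/
lemma smooth_dirDeriv {X : VField n M} {f : M → ℝ} (hX : SmoothVFieldAt X x)
    (hf : SmoothFunAt n f x) : SmoothFunAt n (dirDeriv X f) x := by
  have h1 : ∀ i, SmoothFunAt n (dirDeriv (E i) f) x := by
    intro i
    refine (hE.smooth_coord x hx _ ((hE.smooth x hx i).bracket
      (SmoothVFieldAt.smul hf (hE.smooth x hx i))) i).congr ?_
    filter_upwards [hE.eventually_mem hx, hf.eventually] with y hy hfy
    rw [mlieBracket_smul_right' hfy (hE.smooth y hy i), VectorField.mlieBracket_self]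
    simp [hE.frameCoord_frame hy]
  refine (SmoothFunAt.sum fun i (_ : i ∈ Finset.univ) =>
    (hE.smooth_coord x hx X hX i).mul (h1 i)).congr ?_
  filter_upwards [hE.eventually_mem hx] with y hy
  exact hE.dirDeriv_eq_sum hy X f

lemma smooth_of_coord {X : VField n M}
    (h : ∀ k, SmoothFunAt n (fun y => frameCoord g s E k y (X y)) x) : SmoothVFieldAt X x :=
  (SmoothVFieldAt.sum fun k (_ : k ∈ Finset.univ) =>
    SmoothVFieldAt.smul (h k) (hE.smooth x hx k)).congr (hE.eq_sum hx X)

lemma frameCoord_bracket {X Y : VField n M} (hX : SmoothVFieldAt X x) (hY : SmoothVFieldAt Y x)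
    (k : ι) :
    frameCoord g s E k x (VectorField.mlieBracket (𝓡 n) X Y x)
      = dirDeriv X (fun y => frameCoord g s E k y (Y y)) x
        - dirDeriv Y (fun y => frameCoord g s E k y (X y)) x
        + ∑ i, ∑ j, frameCoord g s E i x (X x) * frameCoord g s E j x (Y x)
            * structCoef g s E i j k x := by
  -- Only the second argument is expanded in the frame; antisymmetry of the bracket then yields the
  -- expansion of the first.
  have h1 : ∀ {X Y : VField n M}, SmoothVFieldAt Y x →
      frameCoord g s E k x (VectorField.mlieBracket (𝓡 n) X Y x)
        = dirDeriv X (fun y => frameCoord g s E k y (Y y)) x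
          + ∑ j, frameCoord g s E j x (Y x)
              * frameCoord g s E k x (VectorField.mlieBracket (𝓡 n) X (E j) x) := by
    intro X Y hY
    rw [mlieBracket_congr (Filter.Eventually.of_forall fun _ => rfl) (hE.eq_sum hx Y),
      mlieBracket_sum_smul (f := fun j y => frameCoord g s E j y (Y y))
        (fun j => hE.smooth_coord x hx Y hY j)
      (fun j => hE.smooth x hx j), Finset.sum_add_distrib, map_add, hE.frameCoord_sum hx, map_sum]
    simp only [map_smul, smul_eq_mul]
  rw [h1 hY, hE.dirDeriv_eq_sum hx Y, sub_add, sub_eq_add_neg, Finset.sum_comm,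
    ← Finset.sum_sub_distrib, ← Finset.sum_neg_distrib]
  congr 1
  refine Finset.sum_congr rfl fun j _ => ?_
  rw [VectorField.mlieBracket_swap_apply, map_neg, h1 hX]
  have h2 : ∀ i, frameCoord g s E i x (X x) * frameCoord g s E j x (Y x)
      * structCoef g s E i j k x = frameCoord g s E j x (Y x) * -(frameCoord g s E i x (X x) *
        frameCoord g s E k x (VectorField.mlieBracket (𝓡 n) (E j) (E i) x)) := by
    intro i
    rw [structCoef_swap g s E j i k x, structCoef]; ring
  simp_rw [h2]
  rw [← Finset.mul_sum, Finset.sum_neg_distrib]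
  ring

end IsOrthoFrame

end OrthoFrame

/-- This is the part of the Koszul formula without derivatives of coordinates, `a`, `b`, `c` being
the coordinates of `X`, `Y`, `Z`. Indices are renamed so that `c` always carries `k`; `s k * s k =
1` then allows the common factor `s k` to be pulled out, which leaves the Christoffel symbols. -/
lemma koszul_cubic_identity {ι : Type*} [Fintype ι] {s : ι → ℝ} (hs : ∀ i, s i * s i = 1)
    (a b c : ι → ℝ) (C : ι → ι → ι → ℝ) :
    ∑ k, s k * (∑ i, ∑ j, a i * b j * C i j k) * c k
      - ∑ k, s k * (∑ i, ∑ j, a i * c j * C i j k) * b k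
      - ∑ k, s k * (∑ i, ∑ j, b i * c j * C i j k) * a k
    = 2 * ∑ k, s k * c k * ∑ i, ∑ j, a i * b j *
        (1 / 2 * (C i j k - s k * s j * C i k j - s k * s i * C j k i)) := by
  have e1 : ∑ k, s k * (∑ i, ∑ j, a i * c j * C i j k) * b k
      = ∑ k, ∑ i, ∑ j, s j * c k * a i * b j * C i k j := by
    simp only [Finset.mul_sum, Finset.sum_mul]
    rw [Finset.sum_comm]
    simp_rw [Finset.sum_comm (s := Finset.univ) (t := Finset.univ)
      (f := fun k j => s k * (a _ * c j * C _ j k) * b k)]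
    rw [Finset.sum_comm]
    exact Finset.sum_congr rfl fun k _ => Finset.sum_congr rfl fun i _ =>
      Finset.sum_congr rfl fun j _ => by ring
  have e2 : ∑ k, s k * (∑ i, ∑ j, b i * c j * C i j k) * a k
      = ∑ k, ∑ i, ∑ j, s i * c k * a i * b j * C j k i := by
    simp only [Finset.mul_sum, Finset.sum_mul]
    rw [Finset.sum_comm]
    simp_rw [Finset.sum_comm (s := Finset.univ) (t := Finset.univ)
      (f := fun k j => s k * (b _ * c j * C _ j k) * a k)]
    rw [Finset.sum_comm]
    refine Finset.sum_congr rfl fun k _ => ?_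
    rw [Finset.sum_comm]
    exact Finset.sum_congr rfl fun i _ => Finset.sum_congr rfl fun j _ => by ring
  rw [e1, e2]
  simp only [Finset.mul_sum, Finset.sum_mul, ← Finset.sum_sub_distrib]
  refine Finset.sum_congr rfl fun k _ => Finset.sum_congr rfl fun i _ =>
    Finset.sum_congr rfl fun j _ => ?_
  linear_combination (c k * a i * b j * (s j * C i k j + s i * C j k i)) * hs k

/-! ### Levi-Civita connection and curvature in an orthonormal frame -/

section LeviCivita

variable {n : ℕ} {M : Type*} [TopologicalSpace M] [ChartedSpace (EuclideanSpace ℝ (Fin n)) M]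
  {ι : Type*} [Fintype ι] [DecidableEq ι] [IsManifold (𝓡 n) ∞ M]

namespace IsOrthoFrame

variable {g : BilinField n M} {s : ι → ℝ} {E : ι → VField n M} {U : Set M}
  (hE : IsOrthoFrame g s E U) {x : M} (hx : x ∈ U)
include hE hx

/-- The metric has constant components `s k` in the frame, so only the coordinates are
differentiated. -/
lemma dirDeriv_inner {X Y Z : VField n M} (hY : SmoothVFieldAt Y x) (hZ : SmoothVFieldAt Z x) :
    mvfderiv (𝓡 n) (fun y => g y (Y y) (Z y)) x (X x)
      = ∑ k, s k * (frameCoord g s E k x (Y x) * dirDeriv X (fun y => frameCoord g s E k y (Z y)) x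
          + dirDeriv X (fun y => frameCoord g s E k y (Y y)) x * frameCoord g s E k x (Z x)) := by
  have h1 : dirDeriv X (fun y => g y (Y y) (Z y)) x = dirDeriv X
      (fun y => ∑ k, s k * (frameCoord g s E k y (Y y) * frameCoord g s E k y (Z y))) x := by
    refine dirDeriv_congr ?_ rfl
    filter_upwards [hE.eventually_mem hx] with y hy
    rw [hE.inner_eq hy]
    exact Finset.sum_congr rfl fun k _ => mul_assoc _ _ _
  refine h1.trans ?_
  rw [dirDeriv_sum fun k => ((hE.smooth_coord x hx Y hY k).mul
    (hE.smooth_coord x hx Z hZ k)).const_mul _]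
  refine Finset.sum_congr rfl fun k _ => ?_
  rw [dirDeriv_const_mul _ ((hE.smooth_coord x hx Y hY k).mul (hE.smooth_coord x hx Z hZ k)),
    dirDeriv_mul (hE.smooth_coord x hx Y hY k) (hE.smooth_coord x hx Z hZ k)]

/-- The derivatives of coordinates coming from the metric terms and from the brackets cancel, except
for two copies of `X` applied to the coordinates of `Y`. The rest is `koszul_cubic_identity`. On the
right-hand side `Z` enters only through its value at `x`. -/
lemma koszul_eq {X Y Z : VField n M} (hX : SmoothVFieldAt X x) (hY : SmoothVFieldAt Y x)
    (hZ : SmoothVFieldAt Z x) :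
    koszul g X Y Z x = 2 * ∑ k, s k * frameCoord g s E k x (Z x) *
      (dirDeriv X (fun y => frameCoord g s E k y (Y y)) x
        + ∑ i, ∑ j, frameCoord g s E i x (X x) * frameCoord g s E j x (Y x)
            * christoffel g s E i j k x) := by
  have cub := koszul_cubic_identity hE.sign_mul_self (fun i => frameCoord g s E i x (X x))
    (fun i => frameCoord g s E i x (Y x)) (fun i => frameCoord g s E i x (Z x))
    (fun i j k => structCoef g s E i j k x)
  rw [koszul, hE.dirDeriv_inner hx hY hZ, hE.dirDeriv_inner hx hX hZ, hE.dirDeriv_inner hx hX hY,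
    hE.inner_eq hx _ (Z x), hE.inner_eq hx _ (Y x), hE.inner_eq hx _ (X x)]
  simp_rw [hE.frameCoord_bracket hx hX hY, hE.frameCoord_bracket hx hX hZ,
    hE.frameCoord_bracket hx hY hZ, mul_add (s _ * frameCoord g s E _ x (Z x)),
    Finset.sum_add_distrib, mul_add (2 : ℝ)]
  simp only [christoffel]
  rw [← cub, Finset.mul_sum]
  simp only [← Finset.sum_add_distrib, ← Finset.sum_sub_distrib]
  exact Finset.sum_congr rfl fun k _ => by ring

lemma frameCoord_nabla {X Y : VField n M} (hX : SmoothVFieldAt X x) (hY : SmoothVFieldAt Y x)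
    (k : ι) :
    frameCoord g s E k x (nabla g X Y x)
      = dirDeriv X (fun y => frameCoord g s E k y (Y y)) x
        + ∑ j, frameCoord g s E j x (Y x) * connForm g s E X j k x := by
  have h1 : nabla g X Y x = ∑ k, (dirDeriv X (fun y => frameCoord g s E k y (Y y)) x
      + ∑ i, ∑ j, frameCoord g s E i x (X x) * frameCoord g s E j x (Y x)
            * christoffel g s E i j k x) • E k x := by
    -- By `koszul_eq` the Koszul expression is linear in the value `z` of the extension, so it is
    -- represented by the vector displayed.
    refine sharp_eq (hE.nondeg hx) fun z => ?_
    rw [hE.koszul_eq hx hX hY (smoothVFieldAt_extendTangent z), extendTangent_self,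
      mul_div_cancel_left₀ _ two_ne_zero, hE.inner_eq hx]
    simp_rw [hE.frameCoord_sum hx]
    exact Finset.sum_congr rfl fun k _ => by ring
  rw [h1, hE.frameCoord_sum hx, Finset.sum_comm]
  congr 1
  refine Finset.sum_congr rfl fun j _ => ?_
  rw [connForm, Finset.mul_sum]
  exact Finset.sum_congr rfl fun i _ => by ring

lemma smooth_connForm {X : VField n M} (hX : SmoothVFieldAt X x) (j k : ι) :
    SmoothFunAt n (connForm g s E X j k) x :=
  SmoothFunAt.sum fun i _ => (hE.smooth_coord x hx X hX i).mul (hE.smooth_christoffel hx i j k)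

lemma smooth_nabla {X Y : VField n M} (hX : SmoothVFieldAt X x) (hY : SmoothVFieldAt Y x) :
    SmoothVFieldAt (nabla g X Y) x := by
  refine hE.smooth_of_coord hx fun k => ?_
  refine ((hE.smooth_dirDeriv hx hX (hE.smooth_coord x hx Y hY k)).add
    (SmoothFunAt.sum fun j (_ : j ∈ Finset.univ) => (hE.smooth_coord x hx Y hY j).mul
      (hE.smooth_connForm hx hX j k))).congr ?_
  filter_upwards [hE.eventually_mem hx, hX.eventually, hY.eventually] with y hy h1 h2
  exact hE.frameCoord_nabla hy h1 h2 k

lemma frameCoord_nabla_nabla {X Y Z : VField n M} (hX : SmoothVFieldAt X x)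
    (hY : SmoothVFieldAt Y x) (hZ : SmoothVFieldAt Z x) (k : ι) :
    frameCoord g s E k x (nabla g X (nabla g Y Z) x)
      = dirDeriv X (dirDeriv Y fun y => frameCoord g s E k y (Z y)) x
        + ∑ j, (frameCoord g s E j x (Z x) * dirDeriv X (connForm g s E Y j k) x
          + dirDeriv X (fun y => frameCoord g s E j y (Z y)) x * connForm g s E Y j k x)
        + ∑ j, (dirDeriv Y (fun y => frameCoord g s E j y (Z y)) x * connForm g s E X j k x
          + frameCoord g s E j x (Z x) * ∑ l, connForm g s E Y j l x * connForm g s E X l k x) := by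
  rw [hE.frameCoord_nabla hx hX (hE.smooth_nabla hx hY hZ)]
  have h1 : dirDeriv X (fun y => frameCoord g s E k y (nabla g Y Z y)) x
      = dirDeriv X (fun y => dirDeriv Y (fun y => frameCoord g s E k y (Z y)) y
        + ∑ j, frameCoord g s E j y (Z y) * connForm g s E Y j k y) x := by
    refine dirDeriv_congr ?_ rfl
    filter_upwards [hE.eventually_mem hx, hY.eventually, hZ.eventually] with y hy h1 h2
    exact hE.frameCoord_nabla hy h1 h2 k
  have hz : ∀ j, SmoothFunAt n (fun y => frameCoord g s E j y (Z y)) x := hE.smooth_coord x hx Z hZ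
  rw [h1, dirDeriv_add (hE.smooth_dirDeriv hx hY (hz k))
    (SmoothFunAt.sum fun j _ => (hz j).mul (hE.smooth_connForm hx hY j k)),
    dirDeriv_sum fun j => (hz j).mul (hE.smooth_connForm hx hY j k)]
  simp_rw [dirDeriv_mul (hz _) (hE.smooth_connForm hx hY _ k), hE.frameCoord_nabla hx hY hZ,
    add_mul, Finset.sum_add_distrib]
  congr 2
  simp_rw [Finset.sum_mul, Finset.mul_sum]
  rw [Finset.sum_comm]
  exact Finset.sum_congr rfl fun j _ => Finset.sum_congr rfl fun l _ => by ring

/-- The curvature form of a connection in an orthonormal frame. -/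
lemma frameCoord_curvature {X Y Z : VField n M} (hX : SmoothVFieldAt X x)
    (hY : SmoothVFieldAt Y x) (hZ : SmoothVFieldAt Z x) (k : ι) :
    frameCoord g s E k x (nabla g X (nabla g Y Z) x - nabla g Y (nabla g X Z) x
        - nabla g (VectorField.mlieBracket (𝓡 n) X Y) Z x)
      = ∑ j, frameCoord g s E j x (Z x) *
        (dirDeriv X (connForm g s E Y j k) x - dirDeriv Y (connForm g s E X j k) x
          - connForm g s E (VectorField.mlieBracket (𝓡 n) X Y) j k x
          + ∑ l, (connForm g s E Y j l x * connForm g s E X l k x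
            - connForm g s E X j l x * connForm g s E Y l k x)) := by
  -- `E k` serves as the nonvanishing field required by `dirDeriv_commutator`, which cancels the
  -- second derivatives of the coordinates of `Z`.
  have hk : E k x ≠ 0 := by
    intro h
    have := hE.frameCoord_frame hx k k
    rw [h] at this
    simp at this
  have hz := hE.smooth_coord x hx Z hZ k
  have com := dirDeriv_commutator hX hY (hE.smooth x hx k) hk hz
    (hE.smooth_dirDeriv hx hX hz) (hE.smooth_dirDeriv hx hY hz)
  rw [map_sub, map_sub, hE.frameCoord_nabla_nabla hx hX hY hZ,
    hE.frameCoord_nabla_nabla hx hY hX hZ, hE.frameCoord_nabla hx (hX.bracket hY) hZ, ← com]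
  have : ∀ a b A A' B B' C D : ℝ, a + A + A' - (b + B + B') - (a - b + C) = D ↔
      A + A' - B - B' - C = D := fun a b A A' B B' C D => by
    constructor <;> intro h <;> linarith
  rw [this]
  simp only [← Finset.sum_add_distrib, ← Finset.sum_sub_distrib]
  refine Finset.sum_congr rfl fun j _ => ?_
  rw [Finset.sum_sub_distrib]
  ring

/-- The exterior derivative of the connection form in terms of the Christoffel symbols. -/
lemma extDeriv_connForm {X Y : VField n M} (hX : SmoothVFieldAt X x)
    (hY : SmoothVFieldAt Y x) (j k : ι) :
    dirDeriv X (connForm g s E Y j k) x - dirDeriv Y (connForm g s E X j k) x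
        - connForm g s E (VectorField.mlieBracket (𝓡 n) X Y) j k x
      = ∑ a, ∑ b, frameCoord g s E a x (X x) * frameCoord g s E b x (Y x) *
        (dirDeriv (E a) (christoffel g s E b j k) x - dirDeriv (E b) (christoffel g s E a j k) x
          - ∑ i, structCoef g s E a b i x * christoffel g s E i j k x) := by
  -- Both terms `X(ω(Y))` and `ω([X,Y])` contain derivatives of the coordinates of the fields; these
  -- cancel in the antisymmetrized combination, so the result depends only on the values of `X` and
  -- `Y` at `x`.
  have h1 : ∀ {X Y : VField n M}, SmoothVFieldAt X x → SmoothVFieldAt Y x →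
      dirDeriv X (connForm g s E Y j k) x
      = ∑ b, dirDeriv X (fun y => frameCoord g s E b y (Y y)) x * christoffel g s E b j k x
        + ∑ a, ∑ b, frameCoord g s E a x (X x) * frameCoord g s E b x (Y x)
          * dirDeriv (E a) (christoffel g s E b j k) x := by
    intro X Y hX hY
    have hY' := hE.smooth_coord x hx Y hY
    unfold connForm
    rw [dirDeriv_sum fun b => (hY' b).mul (hE.smooth_christoffel hx b j k)]
    simp_rw [dirDeriv_mul (hY' _) (hE.smooth_christoffel hx _ j k),
      hE.dirDeriv_eq_sum hx X (christoffel g s E _ j k)]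
    rw [Finset.sum_add_distrib, add_comm]
    congr 1
    simp_rw [Finset.mul_sum]
    rw [Finset.sum_comm]
    exact Finset.sum_congr rfl fun a _ => Finset.sum_congr rfl fun b _ => by ring
  have h2 : connForm g s E (VectorField.mlieBracket (𝓡 n) X Y) j k x
      = ∑ b, dirDeriv X (fun y => frameCoord g s E b y (Y y)) x * christoffel g s E b j k x
        - ∑ b, dirDeriv Y (fun y => frameCoord g s E b y (X y)) x * christoffel g s E b j k x
        + ∑ a, ∑ b, frameCoord g s E a x (X x) * frameCoord g s E b x (Y x)
          * ∑ i, structCoef g s E a b i x * christoffel g s E i j k x := by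
    unfold connForm
    simp_rw [hE.frameCoord_bracket hx hX hY, add_mul, sub_mul, Finset.sum_add_distrib,
      Finset.sum_sub_distrib]
    congr 1
    simp_rw [Finset.sum_mul, Finset.mul_sum]
    rw [Finset.sum_comm]
    refine Finset.sum_congr rfl fun a _ => ?_
    rw [Finset.sum_comm]
    exact Finset.sum_congr rfl fun b _ => Finset.sum_congr rfl fun i _ => by ring
  rw [h1 hX hY, h1 hY hX, h2]
  rw [Finset.sum_comm (f := fun a b => frameCoord g s E a x (Y x) * frameCoord g s E b x (X x)
          * dirDeriv (E a) (christoffel g s E b j k) x)]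
  simp_rw [mul_sub, Finset.sum_sub_distrib, mul_comm (frameCoord g s E _ x (Y x))]
  ring

end IsOrthoFrame

/-- The components `R_{abj}^k` of the curvature in an orthonormal frame. -/
def curvCoef (g : BilinField n M) (s : ι → ℝ) (E : ι → VField n M) (a b j k : ι) (x : M) : ℝ :=
  dirDeriv (E a) (christoffel g s E b j k) x - dirDeriv (E b) (christoffel g s E a j k) x
    - ∑ i, structCoef g s E a b i x * christoffel g s E i j k x
    + ∑ l, (christoffel g s E b j l x * christoffel g s E a l k x
      - christoffel g s E a j l x * christoffel g s E b l k x)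

/-- Tensoriality of the curvature: by `frameCoord_curvature` and `extDeriv_connForm`, the extensions
used to define `riem` contribute only their values at `x`. -/
lemma IsOrthoFrame.frameCoord_riem {g : BilinField n M} {s : ι → ℝ} {E : ι → VField n M}
    {U : Set M} (hE : IsOrthoFrame g s E U) {x : M} (hx : x ∈ U) (u v w : TangentSpace (𝓡 n) x)
    (k : ι) :
    frameCoord g s E k x (riem g x u v w)
      = ∑ j, ∑ a, ∑ b, frameCoord g s E j x w * frameCoord g s E a x u * frameCoord g s E b x v
          * curvCoef g s E a b j k x := by
  rw [riem, hE.frameCoord_curvature hx (smoothVFieldAt_extendTangent u)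
    (smoothVFieldAt_extendTangent v) (smoothVFieldAt_extendTangent w)]
  refine Finset.sum_congr rfl fun j _ => ?_
  rw [hE.extDeriv_connForm hx (smoothVFieldAt_extendTangent u) (smoothVFieldAt_extendTangent v)]
  have h1 : ∀ l, connForm g s E (extendTangent v) j l x * connForm g s E (extendTangent u) l k x
      - connForm g s E (extendTangent u) j l x * connForm g s E (extendTangent v) l k x
      = ∑ a, ∑ b, frameCoord g s E a x u * frameCoord g s E b x v *
        (christoffel g s E b j l x * christoffel g s E a l k x
          - christoffel g s E a j l x * christoffel g s E b l k x) := by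
    intro l
    unfold connForm
    simp_rw [extendTangent_self]
    rw [Finset.sum_mul_sum, Finset.sum_mul_sum, Finset.sum_comm]
    simp_rw [← Finset.sum_sub_distrib]
    exact Finset.sum_congr rfl fun a _ => Finset.sum_congr rfl fun b _ => by ring
  simp_rw [h1, extendTangent_self]
  rw [Finset.sum_comm (f := fun l a => ∑ b, frameCoord g s E a x u * frameCoord g s E b x v *
        (christoffel g s E b j l x * christoffel g s E a l k x
          - christoffel g s E a j l x * christoffel g s E b l k x))]
  rw [← Finset.sum_add_distrib, Finset.mul_sum]
  refine Finset.sum_congr rfl fun a _ => ?_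
  rw [Finset.sum_comm, ← Finset.sum_add_distrib, Finset.mul_sum]
  refine Finset.sum_congr rfl fun b _ => ?_
  rw [← Finset.mul_sum, curvCoef]
  ring

end LeviCivita

end SemiRiem

namespace SemiRiem

/-! ### Projections and traces in orthonormal families -/

section OrthoFamily

variable {E : Type*} [AddCommGroup E] [Module ℝ E] {ι : Type*} [Fintype ι] [DecidableEq ι]

/-- `f` is an orthonormal family with signs `s`. -/
structure IsOrthoFamily (g : LinearMap.BilinForm ℝ E) (s : ι → ℝ) (f : ι → E) : Prop where
  symm : ∀ v w, g v w = g w v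
  sign : ∀ i, s i = 1 ∨ s i = -1
  ortho : ∀ i j, g (f i) (f j) = if i = j then s i else 0

namespace IsOrthoFamily

variable {g : LinearMap.BilinForm ℝ E} {s : ι → ℝ} {f : ι → E} (hf : IsOrthoFamily g s f)
include hf

omit [Fintype ι] in
lemma sign_mul_self (i : ι) : s i * s i = 1 := by
  rcases hf.sign i with h | h <;> rw [h] <;> norm_num

lemma apply_sum (c : ι → ℝ) (k : ι) : g (∑ i, c i • f i) (f k) = c k * s k := by
  rw [map_sum, LinearMap.sum_apply]
  simp [hf.ortho]

lemma linearIndependent : LinearIndependent ℝ f := by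
  rw [Fintype.linearIndependent_iff]
  intro c hc k
  have h := hf.apply_sum c k
  rw [hc, map_zero, LinearMap.zero_apply] at h
  have := hf.sign_mul_self k
  calc c k = c k * s k * s k := by rw [mul_assoc, this, mul_one]
    _ = 0 := by rw [← h, zero_mul]

lemma sum_eq_of_mem_span {v : E} (hv : v ∈ Submodule.span ℝ (range f)) :
    ∑ i, (s i * g v (f i)) • f i = v := by
  obtain ⟨c, rfl⟩ := (Submodule.mem_span_range_iff_exists_fun ℝ).1 hv
  refine Finset.sum_congr rfl fun i _ => ?_
  rw [hf.apply_sum, mul_left_comm, hf.sign_mul_self, mul_one]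

lemma sub_mem_perp (v : E) :
    v - ∑ i, (s i * g v (f i)) • f i ∈ perp g (Submodule.span ℝ (range f)) := by
  intro w hw
  obtain ⟨c, rfl⟩ := (Submodule.mem_span_range_iff_exists_fun ℝ).1 hw
  rw [map_sum]
  refine Finset.sum_eq_zero fun i _ => ?_
  rw [map_smul, map_sub, LinearMap.sub_apply, hf.apply_sum, mul_right_comm, hf.sign_mul_self,
    one_mul, sub_self, smul_zero]

lemma isCompl_perp {U : Submodule ℝ E} (hU : Submodule.span ℝ (range f) = U) :
    IsCompl U (perp g U) := by
  subst hU
  refine ⟨Submodule.disjoint_def.2 fun v hv hv' => ?_, codisjoint_iff.2 ?_⟩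
  · rw [← hf.sum_eq_of_mem_span hv]
    refine Finset.sum_eq_zero fun i _ => ?_
    rw [hv' (f i) (Submodule.subset_span ⟨i, rfl⟩), mul_zero, zero_smul]
  · refine Submodule.eq_top_iff'.2 fun v => ?_
    rw [← add_sub_cancel (∑ i, (s i * g v (f i)) • f i) v]
    refine Submodule.add_mem_sup (Submodule.sum_mem _ fun i _ => ?_) (hf.sub_mem_perp v)
    exact Submodule.smul_mem _ _ (Submodule.subset_span ⟨i, rfl⟩)

lemma proj_eq {U : Submodule ℝ E} (hU : Submodule.span ℝ (range f) = U) (v : E) :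
    proj g U v = ∑ i, (s i * g v (f i)) • f i := by
  have hc := hf.isCompl_perp hU
  rw [proj, dif_pos hc]
  have h1 : ∑ i, (s i * g v (f i)) • f i ∈ U := by
    rw [← hU]
    exact Submodule.sum_mem _ fun i _ => Submodule.smul_mem _ _ (Submodule.subset_span ⟨i, rfl⟩)
  have h2 := hf.sub_mem_perp v
  rw [hU] at h2
  conv_lhs => rw [← add_sub_cancel (∑ i, (s i * g v (f i)) • f i) v]
  rw [map_add, Submodule.projection_apply_of_mem_left hc h1,
    Submodule.projection_apply_of_mem_right hc h2, add_zero]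

/-- The trace over `U` may be computed in any orthonormal basis of `U`. -/
lemma traceOn_eq {U : Submodule ℝ E} (hU : Submodule.span ℝ (range f) = U) {B : E → E → ℝ}
    (hB : ∀ c d : ι → ℝ, B (∑ i, c i • f i) (∑ i, d i • f i)
      = ∑ i, ∑ j, c i * d j * B (f i) (f j)) :
    traceOn g U B = ∑ i, s i * B (f i) (f i) := by
  have hcard : Fintype.card ι = Module.finrank ℝ U := by
    rw [← hU, finrank_span_eq_card hf.linearIndependent]
  have hex : ∃ e : Fin (Module.finrank ℝ U) → E, IsOrthonormalBasisOf g U e := by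
    let σ : Fin (Module.finrank ℝ U) ≃ ι := (Fintype.equivFinOfCardEq hcard).symm
    refine ⟨f ∘ σ, fun i j hij => ?_, fun i => ?_, hf.linearIndependent.comp _ σ.injective, ?_⟩
    · rw [Function.comp_apply, Function.comp_apply, hf.ortho, if_neg (σ.injective.ne hij)]
    · rw [Function.comp_apply, hf.ortho, if_pos rfl]
      exact hf.sign _
    · rw [σ.surjective.range_comp, hU]
  rw [traceOn, dif_pos hex]
  obtain ⟨h1, h2, h3, h4⟩ := hex.choose_spec
  generalize hex.choose = e at *
  have he : IsOrthoFamily g (fun i => g (e i) (e i)) e :=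
    ⟨hf.symm, h2, fun i j => by split_ifs with h <;> [rw [h]; exact h1 i j h]⟩
  -- The transition matrix from `e` to `f` is orthogonal for the indefinite product. This makes all
  -- off-diagonal terms `B (f i) (f j)` drop out below.
  have key : ∀ i j, ∑ ν, g (e ν) (e ν) * (s i * g (e ν) (f i)) * (s j * g (e ν) (f j))
      = if i = j then s i else 0 := by
    intro i j
    have hi : f i ∈ Submodule.span ℝ (range e) := by
      rw [h4, ← hU]
      exact Submodule.subset_span ⟨i, rfl⟩
    have h5 : g (f i) (f j) = ∑ ν, g (e ν) (e ν) * g (e ν) (f i) * g (e ν) (f j) := by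
      conv_lhs => rw [← he.sum_eq_of_mem_span hi]
      rw [map_sum, LinearMap.sum_apply]
      refine Finset.sum_congr rfl fun ν _ => ?_
      rw [map_smul, LinearMap.smul_apply, smul_eq_mul, hf.symm (f i)]
    calc _ = s i * s j * g (f i) (f j) := by
          rw [h5, Finset.mul_sum]
          exact Finset.sum_congr rfl fun ν _ => by ring
      _ = _ := by
          rw [hf.ortho]
          split_ifs with h
          · rw [← h, hf.sign_mul_self, one_mul]
          · rw [mul_zero]
  have hexp : ∀ ν, B (e ν) (e ν)
      = ∑ i, ∑ j, (s i * g (e ν) (f i)) * (s j * g (e ν) (f j)) * B (f i) (f j) := by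
    intro ν
    have hν : e ν ∈ Submodule.span ℝ (range f) := by
      rw [hU, ← h4]
      exact Submodule.subset_span ⟨ν, rfl⟩
    conv_lhs => rw [← hf.sum_eq_of_mem_span hν]
    exact hB _ _
  simp_rw [hexp, Finset.mul_sum]
  rw [Finset.sum_comm]
  refine Finset.sum_congr rfl fun i _ => ?_
  rw [Finset.sum_comm, Finset.sum_eq_single i]
  · have := key i i
    rw [if_pos rfl] at this
    refine Eq.trans ?_ (congrArg (· * B (f i) (f i)) this)
    rw [Finset.sum_mul]
    exact Finset.sum_congr rfl fun ν _ => by ring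
  · intro j _ hj
    have := key i j
    rw [if_neg hj.symm] at this
    rw [← zero_mul (B (f i) (f j)), ← this, Finset.sum_mul]
    exact Finset.sum_congr rfl fun ν _ => by ring
  · simp

end IsOrthoFamily

end OrthoFamily

/-! ### Index and orthogonal complements -/

section Index

variable {E : Type*} [AddCommGroup E] [Module ℝ E] [FiniteDimensional ℝ E]

lemma HasIndex.le_finrank {g : LinearMap.BilinForm ℝ E} {q : ℕ} (h : HasIndex g q) :
    q ≤ Module.finrank ℝ E := by
  obtain ⟨W, hW, -⟩ := h.1
  exact hW ▸ Submodule.finrank_le W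

/-- The orthogonal complement of a maximal positive definite subspace is negative definite. -/
lemma HasIndex.neg_of_mem_perp {g : LinearMap.BilinForm ℝ E} {q : ℕ} (h : HasIndex g q)
    (hsymm : ∀ v w, g v w = g w v) {H : Submodule ℝ E}
    (hH : Module.finrank ℝ H = Module.finrank ℝ E - q)
    (hpos : ∀ v ∈ H, v ≠ 0 → IsSpacelike g v) {v : E} (hv : v ∈ perp g H) (hv0 : v ≠ 0) :
    g v v < 0 := by
  by_contra hneg
  have hle := h.le_finrank
  obtain ⟨W, hW, hWneg⟩ := h.1
  -- If `g v v ≥ 0`, then `g` is positive semidefinite on `H ⊕ ℝv`. This space has dimension `n - q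
  -- + 1` for `n = dim E`, so it meets the `q`-dimensional negative definite space `W` nontrivially,
  -- a contradiction.
  have hvH : v ∉ H := fun hvH => (hpos v hvH hv0).ne' (hv v hvH)
  have hdisj : Disjoint H (Submodule.span ℝ {v}) := by
    exact Submodule.disjoint_span_singleton_of_notMem hvH
  have h1 : Module.finrank ℝ ↥(H ⊔ Submodule.span ℝ {v}) = Module.finrank ℝ H + 1 := by
    have := Submodule.finrank_sup_add_finrank_inf_eq H (Submodule.span ℝ {v})
    rwa [hdisj.eq_bot, finrank_bot, add_zero, finrank_span_singleton hv0] at this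
  have h2 := Submodule.finrank_sup_add_finrank_inf_eq W (H ⊔ Submodule.span ℝ {v})
  have h3 := Submodule.finrank_le (W ⊔ (H ⊔ Submodule.span ℝ {v}))
  have h4 : W ⊓ (H ⊔ Submodule.span ℝ {v}) ≠ ⊥ := by
    intro h
    rw [h, finrank_bot] at h2
    omega
  obtain ⟨w, hw, hw0⟩ := Submodule.exists_mem_ne_zero_of_ne_bot h4
  obtain ⟨a, ha, b, hb, rfl⟩ := Submodule.mem_sup.1 hw.2
  obtain ⟨c, rfl⟩ := Submodule.mem_span_singleton.1 hb
  have h5 : g (a + c • v) (a + c • v) < 0 := hWneg _ hw.1 hw0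
  have h6 : g v a = 0 := hv a ha
  have h7 : g a v = 0 := by rw [hsymm, h6]
  have h8 : 0 ≤ g a a := by
    by_cases ha0 : a = 0
    · simp [ha0]
    · exact (hpos a ha ha0).le
  simp only [map_add, map_smul, LinearMap.add_apply, LinearMap.smul_apply, smul_eq_mul, h6,
    h7] at h5
  nlinarith [mul_nonneg (mul_self_nonneg c) (not_lt.1 hneg)]

/-- Rank-nullity for `v ↦ g(v, ·)` restricted to `H`: the rank is at most `dim H`, and the kernel
lies in `perp g H`. -/
lemma finrank_le_finrank_perp (g : LinearMap.BilinForm ℝ E) (H : Submodule ℝ E) :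
    Module.finrank ℝ E ≤ Module.finrank ℝ H + Module.finrank ℝ (perp g H) := by
  let φ : E →ₗ[ℝ] (H →ₗ[ℝ] ℝ) := g.domRestrict₂ H
  have hker : LinearMap.ker φ ≤ perp g H := by
    intro v hv w hw
    exact LinearMap.congr_fun (LinearMap.mem_ker.1 hv) ⟨w, hw⟩
  have h1 := LinearMap.finrank_range_add_finrank_ker φ
  have h2 := Submodule.finrank_mono hker
  have h3 := Submodule.finrank_le (LinearMap.range φ)
  have h4 : Module.finrank ℝ (H →ₗ[ℝ] ℝ) = Module.finrank ℝ H := Subspace.dual_finrank_eq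
  omega

end Index

/-! ### Ricci tensor in an orthonormal frame -/

section Ricci

variable {n : ℕ} {M : Type*} [TopologicalSpace M] [ChartedSpace (EuclideanSpace ℝ (Fin n)) M]
  {ι : Type*} [Fintype ι] [DecidableEq ι] [IsManifold (𝓡 n) ∞ M]

/-- The components of the Ricci tensor in an orthonormal frame. -/
def ricCoef (g : BilinField n M) (s : ι → ℝ) (E : ι → VField n M) (b j : ι) (x : M) : ℝ :=
  ∑ a, curvCoef g s E a b j a x

namespace IsOrthoFrame

variable {g : BilinField n M} {s : ι → ℝ} {E : ι → VField n M} {U : Set M}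
  (hE : IsOrthoFrame g s E U) {x : M} (hx : x ∈ U)
include hE hx

lemma isOrthoFamily : IsOrthoFamily (g x) s (fun i => E i x) where
  symm v w := by
    rw [hE.inner_eq hx, hE.inner_eq hx]
    exact Finset.sum_congr rfl fun k _ => by ring
  sign := hE.sign
  ortho := hE.ortho x hx

lemma span_eq_top : Submodule.span ℝ (range fun i => E i x) = ⊤ := by
  refine Submodule.eq_top_iff'.2 fun v => ?_
  rw [← hE.span x hx v]
  exact Submodule.sum_mem _ fun i _ => Submodule.smul_mem _ _ (Submodule.subset_span ⟨i, rfl⟩)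

/-- `traceOn_eq` asks for bilinearity of the traced function. For `riem` this is not visible from
the definition; it is read off from `frameCoord_riem`. -/
lemma ric_eq (v w : TangentSpace (𝓡 n) x) :
    ric g x v w = ∑ b, ∑ j, frameCoord g s E b x v * frameCoord g s E j x w
      * ricCoef g s E b j x := by
  rw [ric, (hE.isOrthoFamily hx).traceOn_eq (hE.span_eq_top hx)]
  · have h1 : ∀ a, s a * g x (riem g x (E a x) v w) (E a x)
        = ∑ b, ∑ j, frameCoord g s E b x v * frameCoord g s E j x w
          * curvCoef g s E a b j a x := by
      intro a
      rw [← frameCoord_apply, hE.frameCoord_riem hx, Finset.sum_comm]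
      rw [Finset.sum_eq_single a]
      · rw [Finset.sum_comm]
        refine Finset.sum_congr rfl fun b _ => Finset.sum_congr rfl fun j _ => ?_
        rw [hE.frameCoord_frame hx, if_pos rfl]
        ring
      · intro c _ hc
        refine Finset.sum_eq_zero fun j _ => Finset.sum_eq_zero fun b _ => ?_
        rw [hE.frameCoord_frame hx, if_neg hc.symm]
        ring
      · simp
    simp_rw [h1]
    rw [Finset.sum_comm]
    refine Finset.sum_congr rfl fun b _ => ?_
    rw [Finset.sum_comm]
    refine Finset.sum_congr rfl fun j _ => ?_
    rw [← Finset.mul_sum, ricCoef]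
  · intro c d
    have h2 : ∀ (u : TangentSpace (𝓡 n) x) (i : ι), g x u (E i x) = s i * frameCoord g s E i x u := by
      intro u i
      rw [frameCoord_apply, ← mul_assoc, hE.sign_mul_self, one_mul]
    have h3 : ∀ i, frameCoord g s E i x (riem g x (∑ i, c i • E i x) v w)
        = ∑ a, c a * frameCoord g s E i x (riem g x (E a x) v w) := by
      intro i
      simp_rw [hE.frameCoord_riem hx, hE.frameCoord_sum hx, hE.frameCoord_frame hx,
        Finset.mul_sum]
      rw [Finset.sum_comm]
      refine Finset.sum_congr rfl fun a _ => Finset.sum_congr rfl fun j _ => ?_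
      rw [eq_comm, Finset.sum_eq_single a]
      · exact Finset.sum_congr rfl fun b _ => by rw [if_pos rfl]; ring
      · intro e _ he
        exact Finset.sum_eq_zero fun b _ => by rw [if_neg he.symm]; ring
      · simp
    rw [map_sum]
    simp_rw [map_smul, smul_eq_mul, h2, h3, Finset.mul_sum]
    rw [Finset.sum_comm]
    exact Finset.sum_congr rfl fun a _ => Finset.sum_congr rfl fun i _ => by ring

end IsOrthoFrame

end Ricci

end SemiRiem

namespace SemiRiem

/-! ### Existence of smooth frames adapted to `H ⊕ V` -/

section AdaptedFrame

variable {n : ℕ} {M : Type*} [TopologicalSpace M] [ChartedSpace (EuclideanSpace ℝ (Fin n)) M]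

lemma SmoothFunAt.inv_sqrt {f : M → ℝ} {x : M} (h : SmoothFunAt n f x) (hpos : 0 < f x) :
    SmoothFunAt n (fun y => (√(f y))⁻¹) x := by
  filter_upwards [h, h.continuousAt.eventually (lt_mem_nhds hpos)] with y h1 h2
  have h3 : ContDiffAt ℝ ∞ (fun t : ℝ => (√t)⁻¹) (f y) :=
    (Real.contDiffAt_sqrt h2.ne').inv (Real.sqrt_ne_zero'.2 h2)
  exact h3.contMDiffAt.comp y h1

lemma finrank_tangentSpace (x : M) : Module.finrank ℝ (TangentSpace (𝓡 n) x) = n :=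
  finrank_euclideanSpace_fin

instance finiteDimensional_tangentSpace (x : M) : FiniteDimensional ℝ (TangentSpace (𝓡 n) x) :=
  inferInstanceAs (FiniteDimensional ℝ (EuclideanSpace ℝ (Fin n)))

variable [IsManifold (𝓡 n) ∞ M]

lemma IsSemiRiemannianMetric.smoothFunAt {g : BilinField n M} {q : ℕ}
    (hg : IsSemiRiemannianMetric g q) {X Y : VField n M} {x : M} (hX : SmoothVFieldAt X x)
    (hY : SmoothVFieldAt Y x) : SmoothFunAt n (fun y => g y (X y) (Y y)) x := by
  obtain ⟨G, hG, hgG⟩ := hg.smooth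
  filter_upwards [hX, hY] with y h1 h2
  have h3 := ContMDiffAt.clm_bundle_apply₂ (b := fun y : M => y) (E₁ := TangentSpace (𝓡 n) (M := M))
    (E₂ := TangentSpace (𝓡 n) (M := M)) (E₃ := fun _ : M => ℝ) (hG y) h1 h2
  have h4 := (Bundle.contMDiffAt_section y).1 h3
  refine h4.congr_of_eventuallyEq (Filter.Eventually.of_forall fun z => ?_)
  exact hgG z _ _

/-- Gram–Schmidt orthonormalization of local sections of a distribution on which `g` is
definite. -/
lemma exists_orthonormal_sections {g : BilinField n M} {q : ℕ} (hg : IsSemiRiemannianMetric g q)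
    {D : SubspaceField n M} {x : M} {σ : ℝ} (hσ : σ * σ = 1)
    (hext : ∀ v ∈ D x, ∃ Z : VField n M, Z x = v ∧ SmoothVFieldAt Z x ∧ ∀ᶠ y in 𝓝 x, Z y ∈ D y)
    (hdef : ∀ v ∈ D x, v ≠ 0 → 0 < σ * g x v v) (k : ℕ) (hk : k ≤ Module.finrank ℝ (D x)) :
    ∃ E : Fin k → VField n M, (∀ i, SmoothVFieldAt (E i) x) ∧
      ∀ᶠ y in 𝓝 x, (∀ i, E i y ∈ D y) ∧
        ∀ i j, g y (E i y) (E j y) = if i = j then σ else 0 := by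
  induction k with
  | zero => exact ⟨Fin.elim0, fun i => i.elim0, Filter.Eventually.of_forall fun y =>
      ⟨fun i => i.elim0, fun i => i.elim0⟩⟩
  | succ k ih =>
    obtain ⟨E, hEs, hE⟩ := ih (by omega)
    -- Being orthogonal to the `k` vectors found so far is `k` linear conditions on `D x`, whose
    -- dimension exceeds `k`.
    obtain ⟨v, hv, hv0, hvE⟩ : ∃ v ∈ D x, v ≠ 0 ∧ ∀ i, g x v (E i x) = 0 := by
      let φ : D x →ₗ[ℝ] (Fin k → ℝ) :=
        LinearMap.pi fun i => ((g x).flip (E i x)).comp (D x).subtype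
      have hker : LinearMap.ker φ ≠ ⊥ := LinearMap.ker_ne_bot_of_finrank_lt (by simpa using hk)
      obtain ⟨v, hv, hv0⟩ := Submodule.exists_mem_ne_zero_of_ne_bot hker
      exact ⟨v, v.2, fun h => hv0 (Subtype.ext h), fun i => congrFun (LinearMap.mem_ker.1 hv) i⟩
    obtain ⟨Z, hZx, hZ, hZD⟩ := hext v hv
    -- The correction vanishes at `x`, so `u x = v`. Hence `σ g(u,u)` is positive at `x`, and by
    -- continuity nearby, and `u` can be normalized.
    let u : VField n M := fun y => Z y - ∑ i, (σ * g y (Z y) (E i y)) • E i y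
    have hu : SmoothVFieldAt u x := hZ.sub (SmoothVFieldAt.sum fun i _ =>
      SmoothVFieldAt.smul ((hg.smoothFunAt hZ (hEs i)).const_mul σ) (hEs i))
    have hux : u x = v := by
      simp only [u]
      rw [hZx, sub_eq_self]
      exact Finset.sum_eq_zero fun i _ => by rw [hvE, mul_zero, zero_smul]
    have hr : SmoothFunAt n (fun y => σ * g y (u y) (u y)) x := (hg.smoothFunAt hu hu).const_mul σ
    have hrx : 0 < σ * g x (u x) (u x) := by
      rw [hux]
      exact hdef v hv hv0
    let e : VField n M := fun y => (√(σ * g y (u y) (u y)))⁻¹ • u y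
    refine ⟨Fin.cons e E, fun i => ?_, ?_⟩
    · refine Fin.cases ?_ (fun j => ?_) i
      · exact SmoothVFieldAt.smul (hr.inv_sqrt hrx) hu
      · exact hEs j
    · filter_upwards [hE, hZD, hr.continuousAt.eventually (lt_mem_nhds hrx)] with y ⟨h1, h2⟩ h3 h4
      have huE : ∀ j, g y (u y) (E j y) = 0 := by
        intro j
        simp only [u, map_sub, LinearMap.sub_apply, map_sum, LinearMap.sum_apply, map_smul,
          LinearMap.smul_apply, h2, smul_eq_mul]
        rw [Finset.sum_eq_single j (fun i _ hij => by rw [if_neg hij, mul_zero]) (by simp),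
          if_pos rfl]
        linear_combination (-g y (Z y) (E j y)) * hσ
      have hee : g y (e y) (e y) = σ := by
        simp only [e, map_smul, LinearMap.smul_apply, smul_eq_mul]
        rw [← mul_assoc, ← mul_inv, Real.mul_self_sqrt h4.le, inv_mul_eq_iff_eq_mul₀ h4.ne']
        linear_combination (-g y (u y) (u y)) * hσ
      have heE : ∀ j, g y (e y) (E j y) = 0 := by
        intro j
        simp only [e, map_smul, LinearMap.smul_apply, huE, smul_zero]
      refine ⟨fun i => ?_, fun i j => ?_⟩
      · refine Fin.cases ?_ (fun j => h1 j) i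
        exact Submodule.smul_mem _ _ (Submodule.sub_mem _ h3
          (Submodule.sum_mem _ fun i _ => Submodule.smul_mem _ _ (h1 i)))
      · cases i using Fin.cases <;> cases j using Fin.cases
        · simpa using hee
        · rename_i j
          simpa [(Fin.succ_ne_zero j).symm] using heE j
        · rename_i i
          have := heE i
          rw [hg.symm] at this
          simpa [Fin.succ_ne_zero] using this
        · simpa using h2 _ _

/-- The signs of an orthonormal frame adapted to a space distribution. -/
def adaptedSign (p q : ℕ) : Fin p ⊕ Fin q → ℝ := Sum.elim (fun _ => 1) (fun _ => -1)

/-- An orthonormal frame on `U` the first `n - q` members of which are sections of `H`. -/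
structure IsAdaptedFrame (g : BilinField n M) (q : ℕ) (H : SubspaceField n M)
    (E : Fin (n - q) ⊕ Fin q → VField n M) (U : Set M) : Prop
    extends IsOrthoFrame g (adaptedSign (n - q) q) E U where
  span_inl : ∀ y ∈ U, Submodule.span ℝ (range fun i => E (.inl i) y) = H y
  span_inr : ∀ y ∈ U, Submodule.span ℝ (range fun i => E (.inr i) y) = perp (g y) (H y)

lemma IsDistribution.finrank_eq {p : ℕ} {H : SubspaceField n M} (hH : IsDistribution p H) (x : M) :
    Module.finrank ℝ (H x) = p := by
  obtain ⟨U, hU, s, -, hs⟩ := hH x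
  obtain ⟨h1, h2⟩ := hs x (mem_of_mem_nhds hU)
  rw [← h2, finrank_span_eq_card h1, Fintype.card_fin]

lemma IsDistribution.exists_section {p : ℕ} {H : SubspaceField n M} (hH : IsDistribution p H)
    {x : M} {v : TangentSpace (𝓡 n) x} (hv : v ∈ H x) :
    ∃ Z : VField n M, Z x = v ∧ SmoothVFieldAt Z x ∧ ∀ᶠ y in 𝓝 x, Z y ∈ H y := by
  obtain ⟨U, hU, s, hsm, hs⟩ := hH x
  rw [← (hs x (mem_of_mem_nhds hU)).2] at hv
  obtain ⟨c, rfl⟩ := (Submodule.mem_span_range_iff_exists_fun ℝ).1 hv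
  refine ⟨fun y => ∑ i, c i • s i y, rfl, SmoothVFieldAt.sum fun i _ =>
    SmoothVFieldAt.smul (smoothFunAt_const (c i) x) ?_, ?_⟩
  · filter_upwards [eventually_mem_nhds_iff.2 hU] with y hy using (hsm i).contMDiffAt hy
  · filter_upwards [hU] with y hy
    rw [← (hs y hy).2]
    exact Submodule.sum_mem _ fun i _ => Submodule.smul_mem _ _ (Submodule.subset_span ⟨i, rfl⟩)

/-- Gram–Schmidt is run on `H` with sign `1` and on its complement with sign `-1`; the latter is
negative definite because `g` has index `q` and `dim H = n - q`. A dimension count shows that the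
two families span. -/
theorem exists_adaptedFrame {g : BilinField n M} {q : ℕ} (hg : IsSemiRiemannianMetric g q)
    {H : SubspaceField n M} (hH : IsSpaceDistribution g q H) (x : M) :
    ∃ (U : Set M) (E : Fin (n - q) ⊕ Fin q → VField n M), x ∈ U ∧ IsAdaptedFrame g q H E U := by
  have hqn : q ≤ n := by
    have := (hg.index x).le_finrank
    rwa [finrank_tangentSpace] at this
  have hHdim : ∀ y, Module.finrank ℝ (H y) = n - q := hH.1.finrank_eq
  have hVneg : ∀ v ∈ perp (g x) (H x), v ≠ 0 → 0 < (-1) * g x v v := by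
    intro v hv hv0
    have := (hg.index x).neg_of_mem_perp (hg.symm x)
      (by rw [hHdim, finrank_tangentSpace]) (hH.2 x) hv hv0
    linarith
  have hVdim : q ≤ Module.finrank ℝ (orthDistr g H x) := by
    have h1 : Module.finrank ℝ (TangentSpace (𝓡 n) x) ≤ Module.finrank ℝ (H x)
        + Module.finrank ℝ (orthDistr g H x) := finrank_le_finrank_perp (g x) (H x)
    have h2 := finrank_tangentSpace (n := n) x
    have h3 := hHdim x
    omega
  have hHfam : ∀ {E : Fin (n - q) → VField n M} {y : M}, (∀ i, E i y ∈ H y) →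
      (∀ i j, g y (E i y) (E j y) = if i = j then (1 : ℝ) else 0) →
      Submodule.span ℝ (range fun i => E i y) = H y := by
    intro E y h1 h2
    have hf : IsOrthoFamily (g y) (fun _ => (1 : ℝ)) (fun i => E i y) :=
      ⟨hg.symm y, fun _ => Or.inl rfl, h2⟩
    refine Submodule.eq_of_le_of_finrank_eq (Submodule.span_le.2 ?_) ?_
    · rintro _ ⟨i, rfl⟩
      exact h1 i
    · rw [finrank_span_eq_card hf.linearIndependent, Fintype.card_fin, hHdim]
  obtain ⟨E₁, hE₁s, hE₁⟩ := exists_orthonormal_sections hg (D := H) (x := x) (σ := 1) (by norm_num)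
    (fun v hv => hH.1.exists_section hv) (fun v hv hv0 => by rw [one_mul]; exact hH.2 x v hv hv0)
    (n - q) (hHdim x).ge
  -- The complement is not given by local sections. They are produced by removing from an arbitrary
  -- smooth extension its `H`-component, which the frame `E₁` makes smooth.
  have hVext : ∀ v ∈ orthDistr g H x, ∃ Z : VField n M, Z x = v ∧ SmoothVFieldAt Z x ∧
      ∀ᶠ y in 𝓝 x, Z y ∈ orthDistr g H y := by
    intro v hv
    have hZ := smoothVFieldAt_extendTangent v
    refine ⟨fun y => extendTangent v y - ∑ i, ((1 : ℝ) * g y (extendTangent v y) (E₁ i y)) • E₁ i y,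
      ?_, hZ.sub (SmoothVFieldAt.sum fun i _ => SmoothVFieldAt.smul
        ((hg.smoothFunAt hZ (hE₁s i)).const_mul 1) (hE₁s i)), ?_⟩
    · simp only
      rw [extendTangent_self, sub_eq_self]
      exact Finset.sum_eq_zero fun i _ => by
        rw [hv _ (hE₁.self_of_nhds.1 i), mul_zero, zero_smul]
    · filter_upwards [hE₁] with y ⟨h1, h2⟩
      have hf : IsOrthoFamily (g y) (fun _ => (1 : ℝ)) (fun i => E₁ i y) :=
        ⟨hg.symm y, fun _ => Or.inl rfl, h2⟩
      have := hf.sub_mem_perp (extendTangent v y)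
      rwa [hHfam h1 h2] at this
  obtain ⟨E₂, hE₂s, hE₂⟩ := exists_orthonormal_sections hg (D := orthDistr g H) (x := x) (σ := -1)
    (by norm_num) hVext hVneg q hVdim
  have hs : ∀ i, SmoothVFieldAt (Sum.elim E₁ E₂ i) x := by
    rintro (i | i)
    · exact hE₁s i
    · exact hE₂s i
  have hev : ∀ᶠ y in 𝓝 x, (∀ i, SmoothVFieldAt (Sum.elim E₁ E₂ i) y) ∧
      ((∀ i, E₁ i y ∈ H y) ∧ ∀ i j, g y (E₁ i y) (E₁ j y) = if i = j then (1 : ℝ) else 0) ∧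
      ((∀ i, E₂ i y ∈ orthDistr g H y) ∧
        ∀ i j, g y (E₂ i y) (E₂ j y) = if i = j then (-1 : ℝ) else 0) := by
    filter_upwards [Filter.eventually_all.2 fun i => (hs i).eventually, hE₁, hE₂] with y h1 h2 h3
      using ⟨h1, h2, h3⟩
  obtain ⟨U, hU, hUo, hxU⟩ := eventually_nhds_iff.1 hev
  have hfam : ∀ y ∈ U, IsOrthoFamily (g y) (adaptedSign (n - q) q)
      (fun i => Sum.elim E₁ E₂ i y) := by
    intro y hy
    obtain ⟨-, ⟨h1, h2⟩, h3, h4⟩ := hU y hy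
    refine ⟨hg.symm y, ?_, ?_⟩
    · rintro (i | i) <;> simp [adaptedSign]
    · rintro (i | i) (j | j)
      · simpa [adaptedSign] using h2 i j
      · have : g y (E₁ i y) (E₂ j y) = 0 := by
          rw [hg.symm]
          exact h3 j _ (h1 i)
        simpa using this
      · simpa using h3 i _ (h1 j)
      · simpa [adaptedSign] using h4 i j
  refine ⟨U, Sum.elim E₁ E₂, hxU, ⟨hUo, ?_, fun y hy => (hU y hy).1, fun y hy => (hfam y hy).ortho,
    ?_, ?_⟩, fun y hy => hHfam (hU y hy).2.1.1 (hU y hy).2.1.2, ?_⟩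
  · exact (hfam x hxU).sign
  · intro y hy v
    have htop : Submodule.span ℝ (range fun i => Sum.elim E₁ E₂ i y) = ⊤ := by
      refine (hfam y hy).linearIndependent.span_eq_top_of_card_eq_finrank' ?_
      rw [finrank_tangentSpace, Fintype.card_sum, Fintype.card_fin, Fintype.card_fin]
      omega
    exact (hfam y hy).sum_eq_of_mem_span (htop ▸ Submodule.mem_top)
  · intro y hy Z hZ k
    exact (hg.smoothFunAt hZ ((hU y hy).1 k)).const_mul _
  · intro y hy
    obtain ⟨-, ⟨h1, h2⟩, h3, h4⟩ := hU y hy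
    have hf : IsOrthoFamily (g y) (fun _ => (1 : ℝ)) (fun i => E₁ i y) :=
        ⟨hg.symm y, fun _ => Or.inl rfl, h2⟩
    have hf2 : IsOrthoFamily (g y) (fun _ => (-1 : ℝ)) (fun i => E₂ i y) :=
        ⟨hg.symm y, fun _ => Or.inr rfl, h4⟩
    have hc := (hf.isCompl_perp (hHfam h1 h2))
    have hdim := Submodule.finrank_add_eq_of_isCompl hc
    rw [finrank_tangentSpace, hHdim] at hdim
    refine Submodule.eq_of_le_of_finrank_eq (Submodule.span_le.2 ?_) ?_
    · rintro _ ⟨i, rfl⟩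
      exact h3 i
    · refine (finrank_span_eq_card hf2.linearIndependent).trans ?_
      rw [Fintype.card_fin]
      omega

end AdaptedFrame

end SemiRiem

namespace SemiRiem

/-! ### The rescaled frame of the stretched metric, and the twistedness -/

section Stretch

variable {n : ℕ} {M : Type*} [TopologicalSpace M] [ChartedSpace (EuclideanSpace ℝ (Fin n)) M]
  [IsManifold (𝓡 n) ∞ M]

/-- The factors by which the members of an adapted frame are rescaled. -/
def frameScale (p q : ℕ) (ε : ℝ) : Fin p ⊕ Fin q → ℝ := Sum.elim (fun _ => 1) (fun _ => ε)

/-- The frame obtained from an adapted frame by multiplying the vertical members by `ε`. -/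
def scaledFrame {p q : ℕ} (ε : ℝ) (E : Fin p ⊕ Fin q → VField n M) : Fin p ⊕ Fin q → VField n M :=
  fun i y => frameScale p q ε i • E i y

lemma frameScale_ne_zero {p q : ℕ} {ε : ℝ} (hε : ε ≠ 0) (i : Fin p ⊕ Fin q) :
    frameScale p q ε i ≠ 0 := by
  rcases i with i | i <;> simp [frameScale, hε]

namespace IsAdaptedFrame

variable {g : BilinField n M} {q : ℕ} {H : SubspaceField n M}
  {E : Fin (n - q) ⊕ Fin q → VField n M} {U : Set M} (hE : IsAdaptedFrame g q H E U) {x : M}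
  (hx : x ∈ U)
include hE hx

lemma family_inl : IsOrthoFamily (g x) (fun _ => (1 : ℝ)) (fun i => E (.inl i) x) where
  symm := (hE.isOrthoFamily hx).symm
  sign _ := Or.inl rfl
  ortho i j := by simpa [adaptedSign] using hE.ortho x hx (.inl i) (.inl j)

lemma family_inr : IsOrthoFamily (g x) (fun _ => (-1 : ℝ)) (fun i => E (.inr i) x) where
  symm := (hE.isOrthoFamily hx).symm
  sign _ := Or.inr rfl
  ortho i j := by simpa [adaptedSign] using hE.ortho x hx (.inr i) (.inr j)

lemma proj_horizontal (v : TangentSpace (𝓡 n) x) :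
    proj (g x) (H x) v
      = ∑ i, frameCoord g (adaptedSign (n - q) q) E (.inl i) x v • E (.inl i) x :=
  (hE.family_inl hx).proj_eq (hE.span_inl x hx) v

lemma proj_vertical (v : TangentSpace (𝓡 n) x) :
    proj (g x) (orthDistr g H x) v
      = ∑ i, frameCoord g (adaptedSign (n - q) q) E (.inr i) x v • E (.inr i) x :=
  (hE.family_inr hx).proj_eq (hE.span_inr x hx) v

lemma frameCoord_proj_horizontal (v : TangentSpace (𝓡 n) x) (k : Fin (n - q) ⊕ Fin q) :
    frameCoord g (adaptedSign (n - q) q) E k x (proj (g x) (H x) v)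
      = Sum.elim (fun i => frameCoord g (adaptedSign (n - q) q) E (.inl i) x v) (fun _ => 0) k := by
  rw [hE.proj_horizontal hx, map_sum]
  simp_rw [map_smul, hE.frameCoord_frame hx]
  rcases k with k | k <;> simp

lemma frameCoord_proj_vertical (v : TangentSpace (𝓡 n) x) (k : Fin (n - q) ⊕ Fin q) :
    frameCoord g (adaptedSign (n - q) q) E k x (proj (g x) (orthDistr g H x) v)
      = Sum.elim (fun _ => 0) (fun i => frameCoord g (adaptedSign (n - q) q) E (.inr i) x v) k := by
  rw [hE.proj_vertical hx, map_sum]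
  simp_rw [map_smul, hE.frameCoord_frame hx]
  rcases k with k | k <;> simp

lemma gV_apply (v w : TangentSpace (𝓡 n) x) :
    gV g (orthDistr g H) x v w = ∑ i, frameCoord g (adaptedSign (n - q) q) E (.inr i) x v
      * frameCoord g (adaptedSign (n - q) q) E (.inr i) x w := by
  have h1 : gV g (orthDistr g H) x v w
      = -g x (proj (g x) (orthDistr g H x) v) (proj (g x) (orthDistr g H x) w) := rfl
  rw [h1, hE.inner_eq hx]
  simp_rw [hE.frameCoord_proj_vertical hx]
  simp [adaptedSign]

lemma gH_apply (v w : TangentSpace (𝓡 n) x) :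
    gH g (orthDistr g H) x v w = ∑ i, frameCoord g (adaptedSign (n - q) q) E (.inl i) x v
      * frameCoord g (adaptedSign (n - q) q) E (.inl i) x w := by
  have h1 : gH g (orthDistr g H) x v w
      = g x (v - proj (g x) (orthDistr g H x) v) (w - proj (g x) (orthDistr g H x) w) := rfl
  rw [h1, hE.inner_eq hx]
  simp_rw [map_sub, hE.frameCoord_proj_vertical hx]
  simp [adaptedSign]

lemma switch_apply (v w : TangentSpace (𝓡 n) x) :
    switch g (orthDistr g H) x v w = ∑ i, frameCoord g (adaptedSign (n - q) q) E i x v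
      * frameCoord g (adaptedSign (n - q) q) E i x w := by
  have h1 : switch g (orthDistr g H) x v w
      = gV g (orthDistr g H) x v w + gH g (orthDistr g H) x v w := rfl
  rw [h1, hE.gV_apply hx, hE.gH_apply hx, Fintype.sum_sum_type, add_comm]

lemma stretch_apply (ε : ℝ) (v w : TangentSpace (𝓡 n) x) :
    stretch g (fun _ => ε) (orthDistr g H) x v w = ∑ i, adaptedSign (n - q) q i *
      ((frameScale (n - q) q ε i)⁻¹ * frameCoord g (adaptedSign (n - q) q) E i x v)
      * ((frameScale (n - q) q ε i)⁻¹ * frameCoord g (adaptedSign (n - q) q) E i x w) := by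
  have h1 : stretch g (fun _ => ε) (orthDistr g H) x v w
      = -(1 / ε ^ 2) * gV g (orthDistr g H) x v w + gH g (orthDistr g H) x v w := rfl
  rw [h1, hE.gV_apply hx, hE.gH_apply hx, Fintype.sum_sum_type, add_comm, Finset.mul_sum]
  congr 1
  · exact Finset.sum_congr rfl fun i _ => by simp [adaptedSign, frameScale]
  · refine Finset.sum_congr rfl fun i _ => ?_
    simp only [adaptedSign, frameScale, Sum.elim_inr, one_div, ← inv_pow]
    ring

/-- Coordinates are dual to the frame, so they scale by the inverse factor. -/
lemma frameCoord_stretch {ε : ℝ} (hε : ε ≠ 0) (k : Fin (n - q) ⊕ Fin q)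
    (v : TangentSpace (𝓡 n) x) :
    frameCoord (stretch g (fun _ => ε) (orthDistr g H)) (adaptedSign (n - q) q) (scaledFrame ε E)
        k x v
      = (frameScale (n - q) q ε k)⁻¹ * frameCoord g (adaptedSign (n - q) q) E k x v := by
  rw [frameCoord_apply, scaledFrame, map_smul, smul_eq_mul, hE.stretch_apply hx,
    Finset.sum_eq_single k]
  · rw [hE.frameCoord_frame hx, if_pos rfl]
    have h1 := hE.sign_mul_self k
    have h2 := mul_inv_cancel₀ (frameScale_ne_zero hε k)
    linear_combination (frameCoord g (adaptedSign (n - q) q) E k x v)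
      * ((frameScale (n - q) q ε k)⁻¹ * h1 + adaptedSign (n - q) q k * adaptedSign (n - q) q k *
        (frameScale (n - q) q ε k)⁻¹ * h2)
  · intro i _ hi
    rw [hE.frameCoord_frame hx, if_neg hi.symm]
    ring
  · simp

omit hx in
-- The new coordinates are constant multiples of the old ones. Thus `smooth_coord` is inherited, and
-- smoothness of the stretched metric itself is never needed.
lemma isOrthoFrame_stretch {ε : ℝ} (hε : ε ≠ 0) :
    IsOrthoFrame (stretch g (fun _ => ε) (orthDistr g H)) (adaptedSign (n - q) q)
      (scaledFrame ε E) U where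
  isOpen := hE.isOpen
  sign := hE.sign
  smooth x hx i := SmoothVFieldAt.smul (smoothFunAt_const _ x) (hE.smooth x hx i)
  ortho x hx i j := by
    have h1 := hE.frameCoord_stretch hx hε j (scaledFrame ε E i x)
    rw [frameCoord_apply] at h1
    have h2 : frameCoord g (adaptedSign (n - q) q) E j x (scaledFrame ε E i x)
        = frameScale (n - q) q ε i * if i = j then 1 else 0 := by
      rw [scaledFrame, map_smul, hE.frameCoord_frame hx, smul_eq_mul]
    rw [h2] at h1
    calc _ = adaptedSign (n - q) q j * (adaptedSign (n - q) q j *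
        stretch g (fun _ => ε) (orthDistr g H) x (scaledFrame ε E i x) (scaledFrame ε E j x)) := by
          rw [← mul_assoc, hE.sign_mul_self, one_mul]
      _ = _ := by
        rw [h1]
        split_ifs with h
        · rw [h, mul_one, inv_mul_cancel₀ (frameScale_ne_zero hε j), mul_one]
        · simp
  span x hx v := by
    conv_rhs => rw [← hE.span x hx v]
    refine Finset.sum_congr rfl fun k _ => ?_
    rw [hE.frameCoord_stretch hx hε, scaledFrame, smul_smul, mul_right_comm,
      inv_mul_cancel₀ (frameScale_ne_zero hε k), one_mul]
  smooth_coord x hx Z hZ k := by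
    refine ((hE.smooth_coord x hx Z hZ k).const_mul (frameScale (n - q) q ε k)⁻¹).congr ?_
    filter_upwards [hE.eventually_mem hx] with y hy
    exact hE.frameCoord_stretch hy hε k (Z y)

/-- Structure coefficients of the rescaled frame. -/
lemma structCoef_stretch {ε : ℝ} (hε : ε ≠ 0) (i j k : Fin (n - q) ⊕ Fin q) :
    structCoef (stretch g (fun _ => ε) (orthDistr g H)) (adaptedSign (n - q) q) (scaledFrame ε E)
        i j k x
      = frameScale (n - q) q ε i * frameScale (n - q) q ε j * (frameScale (n - q) q ε k)⁻¹
        * structCoef g (adaptedSign (n - q) q) E i j k x := by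
  have h1 : VectorField.mlieBracket (𝓡 n) (scaledFrame ε E i) (scaledFrame ε E j) x
      = frameScale (n - q) q ε j • frameScale (n - q) q ε i •
        VectorField.mlieBracket (𝓡 n) (E i) (E j) x := by
    refine (VectorField.mlieBracket_const_smul_right (hE.smooth x hx j).mdiff).trans ?_
    congr 1
    exact VectorField.mlieBracket_const_smul_left (hE.smooth x hx i).mdiff
  rw [structCoef, hE.frameCoord_stretch hx hε, h1, map_smul, map_smul, smul_eq_mul, smul_eq_mul,
    structCoef]
  ring

/-- The vertical coordinates of sections of `H` vanish identically near `x`, so the derivative terms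
of `frameCoord_bracket` disappear and the bracket is tensorial modulo `H`. The minus sign is the
sign of the vertical frame vectors. -/
lemma tw_apply (u v w : TangentSpace (𝓡 n) x) (hw : w ∈ orthDistr g H x) :
    tw g H x u v w = -∑ l, frameCoord g (adaptedSign (n - q) q) E (.inr l) x w *
      ∑ a, ∑ b, frameCoord g (adaptedSign (n - q) q) E (.inl a) x u
        * frameCoord g (adaptedSign (n - q) q) E (.inl b) x v
        * structCoef g (adaptedSign (n - q) q) E (.inl a) (.inl b) (.inr l) x := by
  have hsm : ∀ u : TangentSpace (𝓡 n) x, SmoothVFieldAt (extendIn g H u) x := by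
    intro u
    refine (SmoothVFieldAt.sum fun i (_ : i ∈ Finset.univ) => SmoothVFieldAt.smul
      (hE.smooth_coord x hx _ (smoothVFieldAt_extendTangent u) (.inl i))
      (hE.smooth x hx (.inl i))).congr ?_
    filter_upwards [hE.eventually_mem hx] with y hy
    exact hE.proj_horizontal hy _
  have hcoord : ∀ (u : TangentSpace (𝓡 n) x) k,
      frameCoord g (adaptedSign (n - q) q) E k x (extendIn g H u x)
      = Sum.elim (fun i => frameCoord g (adaptedSign (n - q) q) E (.inl i) x u)
        (fun _ => 0) k := by
    intro u k
    refine (hE.frameCoord_proj_horizontal hx _ k).trans ?_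
    rw [extendTangent_self]
  have hder : ∀ (X : VField n M) (u : TangentSpace (𝓡 n) x) l, dirDeriv X
      (fun y => frameCoord g (adaptedSign (n - q) q) E (.inr l) y (extendIn g H u y)) x = 0 := by
    intro X u l
    rw [← dirDeriv_const X 0 x]
    refine dirDeriv_congr ?_ rfl
    filter_upwards [hE.eventually_mem hx] with y hy
    exact hE.frameCoord_proj_horizontal hy _ (.inr l)
  have hw0 : ∀ a, frameCoord g (adaptedSign (n - q) q) E (.inl a) x w = 0 := by
    intro a
    rw [frameCoord_apply, hw _ (by rw [← hE.span_inl x hx]; exact Submodule.subset_span ⟨a, rfl⟩),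
      mul_zero]
  rw [tw, hE.inner_eq hx, Fintype.sum_sum_type]
  simp_rw [hw0, mul_zero, Finset.sum_const_zero, zero_add]
  rw [← Finset.sum_neg_distrib]
  refine Finset.sum_congr rfl fun l _ => ?_
  rw [hE.frameCoord_bracket hx (hsm u) (hsm v), hder, hder]
  simp_rw [Fintype.sum_sum_type, hcoord]
  simp [adaptedSign]
  ring

end IsAdaptedFrame

end Stretch

end SemiRiem

namespace SemiRiem

/-! ### The form `b` in an adapted frame -/

section BForm

variable {n : ℕ} {M : Type*} [TopologicalSpace M] [ChartedSpace (EuclideanSpace ℝ (Fin n)) M]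
  [IsManifold (𝓡 n) ∞ M]

/-- The components of the form `b` in an adapted frame with structure coefficients `C`. -/
def bCoef {p q : ℕ} (C : Fin p ⊕ Fin q → Fin p ⊕ Fin q → Fin p ⊕ Fin q → ℝ) :
    Fin p ⊕ Fin q → Fin p ⊕ Fin q → ℝ
  | .inl i, .inl j => 2 * ∑ a, ∑ l, C (.inl i) (.inl a) (.inr l) * C (.inl j) (.inl a) (.inr l)
  | .inr l, .inr m => ∑ a, ∑ c, C (.inl a) (.inl c) (.inr l) * C (.inl a) (.inl c) (.inr m)
  | _, _ => 0

namespace IsAdaptedFrame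

variable {g : BilinField n M} {q : ℕ} {H : SubspaceField n M}
  {E : Fin (n - q) ⊕ Fin q → VField n M} {U : Set M} (hE : IsAdaptedFrame g q H E U) {x : M}
  (hx : x ∈ U)
include hE hx

lemma mem_orthDistr (l : Fin q) : E (.inr l) x ∈ orthDistr g H x := by
  have := hE.span_inr x hx
  rw [orthDistr, ← this]
  exact Submodule.subset_span ⟨l, rfl⟩

lemma proj_vertical_mem (v : TangentSpace (𝓡 n) x) :
    proj (g x) (orthDistr g H x) v ∈ orthDistr g H x := by
  rw [hE.proj_vertical hx]
  exact Submodule.sum_mem _ fun i _ => Submodule.smul_mem _ _ (hE.mem_orthDistr hx i)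

/-- Linearity in the first two slots is needed to evaluate the traces in `bForm`. It holds only for
`w` orthogonal to `H`, where `tw_apply` exhibits `tw` as a linear function. -/
lemma tw_sum_right {κ : Type*} [Fintype κ] (c : κ → ℝ) (f : κ → TangentSpace (𝓡 n) x)
    (u w : TangentSpace (𝓡 n) x) (hw : w ∈ orthDistr g H x) :
    tw g H x u (∑ i, c i • f i) w = ∑ i, c i * tw g H x u (f i) w := by
  let F : TangentSpace (𝓡 n) x →ₗ[ℝ] ℝ :=
    -∑ l, frameCoord g (adaptedSign (n - q) q) E (.inr l) x w •
      ∑ a, ∑ b, (frameCoord g (adaptedSign (n - q) q) E (.inl a) x u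
        * structCoef g (adaptedSign (n - q) q) E (.inl a) (.inl b) (.inr l) x) •
        frameCoord g (adaptedSign (n - q) q) E (.inl b) x
  have hF : ∀ v, tw g H x u v w = F v := by
    intro v
    rw [hE.tw_apply hx u v w hw]
    simp only [F, LinearMap.neg_apply, LinearMap.sum_apply, LinearMap.smul_apply, smul_eq_mul]
    congr 1
    refine Finset.sum_congr rfl fun l _ => ?_
    congr 1
    exact Finset.sum_congr rfl fun a _ => Finset.sum_congr rfl fun b _ => by ring
  simp_rw [hF, map_sum, map_smul, smul_eq_mul]

omit hE hx in
lemma tw_swap (u v w : TangentSpace (𝓡 n) x) : tw g H x v u w = -tw g H x u v w := by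
  rw [tw, VectorField.mlieBracket_swap_apply, map_neg, LinearMap.neg_apply, tw]

lemma tw_sum_left {κ : Type*} [Fintype κ] (c : κ → ℝ) (f : κ → TangentSpace (𝓡 n) x)
    (v w : TangentSpace (𝓡 n) x) (hw : w ∈ orthDistr g H x) :
    tw g H x (∑ i, c i • f i) v w = ∑ i, c i * tw g H x (f i) v w := by
  rw [tw_swap, hE.tw_sum_right hx c f v w hw, ← Finset.sum_neg_distrib]
  exact Finset.sum_congr rfl fun i _ => by rw [tw_swap]; ring

omit [IsManifold (𝓡 n) ∞ M] hE hx in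
lemma sum_mul_sum_pair {κ : Type*} [Fintype κ] (c d a b : κ → ℝ) :
    (∑ i, c i * a i) * ∑ i, d i * b i = ∑ i, ∑ j, c i * d j * (a i * b j) := by
  rw [Finset.sum_mul_sum]
  exact Finset.sum_congr rfl fun i _ => Finset.sum_congr rfl fun j _ => by ring

lemma tw_frame (i a : Fin (n - q)) (l : Fin q) :
    tw g H x (E (.inl i) x) (E (.inl a) x) (E (.inr l) x)
      = -structCoef g (adaptedSign (n - q) q) E (.inl i) (.inl a) (.inr l) x := by
  rw [hE.tw_apply hx _ _ _ (hE.mem_orthDistr hx l)]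
  simp_rw [hE.frameCoord_frame hx]
  simp

/-- The traces are evaluated from the inside out in the frame. The trace over `V` carries the sign
`-1`, which turns the factor `-2` of the definition into the `2` of `bCoef`. -/
lemma bForm_eq (v w : TangentSpace (𝓡 n) x) :
    bForm g H x v w = ∑ i, ∑ j, frameCoord g (adaptedSign (n - q) q) E i x v
      * frameCoord g (adaptedSign (n - q) q) E j x w
      * bCoef (fun i j k => structCoef g (adaptedSign (n - q) q) E i j k x) i j := by
  have hV := hE.mem_orthDistr hx
  have e1 : ∀ a a' : TangentSpace (𝓡 n) x,
      traceOn (g x) (orthDistr g H x) (fun b b' =>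
        tw g H x (proj (g x) (H x) v) a b * tw g H x (proj (g x) (H x) w) a' b')
      = ∑ l, (-1) * (tw g H x (proj (g x) (H x) v) a (E (.inr l) x)
          * tw g H x (proj (g x) (H x) w) a' (E (.inr l) x)) := by
    intro a a'
    refine (hE.family_inr hx).traceOn_eq (hE.span_inr x hx) fun c d => ?_
    rw [← sum_mul_sum_pair]
    simp only [tw, map_sum, map_smul, smul_eq_mul]
  have e2 : traceOn (g x) (H x) (fun a a' => traceOn (g x) (orthDistr g H x) (fun b b' =>
        tw g H x (proj (g x) (H x) v) a b * tw g H x (proj (g x) (H x) w) a' b'))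
      = ∑ a, 1 * ∑ l, (-1) * (tw g H x (proj (g x) (H x) v) (E (.inl a) x) (E (.inr l) x)
          * tw g H x (proj (g x) (H x) w) (E (.inl a) x) (E (.inr l) x)) := by
    simp_rw [e1]
    refine (hE.family_inl hx).traceOn_eq (hE.span_inl x hx) fun c d => ?_
    simp_rw [hE.tw_sum_right hx _ _ _ _ (hV _), sum_mul_sum_pair, Finset.mul_sum]
    rw [Finset.sum_comm]
    refine Finset.sum_congr rfl fun i _ => ?_
    rw [Finset.sum_comm]
    exact Finset.sum_congr rfl fun j _ => Finset.sum_congr rfl fun l _ => by ring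
  have hv' := hE.proj_vertical_mem hx v
  have hw' := hE.proj_vertical_mem hx w
  have e3 : ∀ a a' : TangentSpace (𝓡 n) x,
      traceOn (g x) (H x) (fun b b' => tw g H x a b (proj (g x) (orthDistr g H x) v)
        * tw g H x a' b' (proj (g x) (orthDistr g H x) w))
      = ∑ c, 1 * (tw g H x a (E (.inl c) x) (proj (g x) (orthDistr g H x) v)
        * tw g H x a' (E (.inl c) x) (proj (g x) (orthDistr g H x) w)) := by
    intro a a'
    refine (hE.family_inl hx).traceOn_eq (hE.span_inl x hx) fun c d => ?_
    rw [← sum_mul_sum_pair, hE.tw_sum_right hx _ _ _ _ hv', hE.tw_sum_right hx _ _ _ _ hw']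
  have e4 : traceOn (g x) (H x) (fun a a' => traceOn (g x) (H x) (fun b b' =>
        tw g H x a b (proj (g x) (orthDistr g H x) v)
        * tw g H x a' b' (proj (g x) (orthDistr g H x) w)))
      = ∑ a, 1 * ∑ c, 1 * (tw g H x (E (.inl a) x) (E (.inl c) x)
          (proj (g x) (orthDistr g H x) v)
        * tw g H x (E (.inl a) x) (E (.inl c) x) (proj (g x) (orthDistr g H x) w)) := by
    simp_rw [e3]
    refine (hE.family_inl hx).traceOn_eq (hE.span_inl x hx) fun c d => ?_
    simp_rw [hE.tw_sum_left hx _ _ _ _ hv', hE.tw_sum_left hx _ _ _ _ hw', sum_mul_sum_pair,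
      Finset.mul_sum]
    rw [Finset.sum_comm]
    refine Finset.sum_congr rfl fun i _ => ?_
    rw [Finset.sum_comm]
    exact Finset.sum_congr rfl fun j _ => Finset.sum_congr rfl fun l _ => by ring
  have hH : ∀ (v : TangentSpace (𝓡 n) x) a l,
      tw g H x (proj (g x) (H x) v) (E (.inl a) x) (E (.inr l) x)
      = ∑ i, frameCoord g (adaptedSign (n - q) q) E (.inl i) x v *
        -structCoef g (adaptedSign (n - q) q) E (.inl i) (.inl a) (.inr l) x := by
    intro v a l
    rw [hE.proj_horizontal hx, hE.tw_sum_left hx _ _ _ _ (hV l)]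
    simp_rw [hE.tw_frame hx]
  have hVv : ∀ (v : TangentSpace (𝓡 n) x) a c,
      tw g H x (E (.inl a) x) (E (.inl c) x) (proj (g x) (orthDistr g H x) v)
      = ∑ l, frameCoord g (adaptedSign (n - q) q) E (.inr l) x v *
        -structCoef g (adaptedSign (n - q) q) E (.inl a) (.inl c) (.inr l) x := by
    intro v a c
    rw [hE.proj_vertical hx, tw]
    simp only [map_sum, map_smul, smul_eq_mul]
    exact Finset.sum_congr rfl fun l _ => by rw [← hE.tw_frame hx, tw]
  rw [bForm, e2, e4]
  simp_rw [hH, hVv, sum_mul_sum_pair, Fintype.sum_sum_type, bCoef, mul_zero,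
    Finset.sum_const_zero, add_zero, zero_add]
  congr 1
  · simp_rw [Finset.mul_sum]
    have : ∀ a, ∑ l, ∑ i, ∑ j, -2 * (1 * (-1 * (frameCoord g (adaptedSign (n - q) q) E (.inl i) x v
        * frameCoord g (adaptedSign (n - q) q) E (.inl j) x w *
        (-structCoef g (adaptedSign (n - q) q) E (.inl i) (.inl a) (.inr l) x *
        -structCoef g (adaptedSign (n - q) q) E (.inl j) (.inl a) (.inr l) x))))
        = ∑ i, ∑ j, ∑ l, -2 * (1 * (-1 * (frameCoord g (adaptedSign (n - q) q) E (.inl i) x v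
        * frameCoord g (adaptedSign (n - q) q) E (.inl j) x w *
        (-structCoef g (adaptedSign (n - q) q) E (.inl i) (.inl a) (.inr l) x *
        -structCoef g (adaptedSign (n - q) q) E (.inl j) (.inl a) (.inr l) x)))) := by
      intro a
      rw [Finset.sum_comm]
      exact Finset.sum_congr rfl fun i _ => Finset.sum_comm
    simp_rw [this]
    rw [Finset.sum_comm]
    refine Finset.sum_congr rfl fun i _ => ?_
    rw [Finset.sum_comm]
    exact Finset.sum_congr rfl fun j _ => Finset.sum_congr rfl fun a _ =>
      Finset.sum_congr rfl fun l _ => by ring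
  · simp_rw [Finset.mul_sum]
    have : ∀ a, ∑ c, ∑ i, ∑ j, 1 * (1 * (frameCoord g (adaptedSign (n - q) q) E (.inr i) x v
        * frameCoord g (adaptedSign (n - q) q) E (.inr j) x w *
        (-structCoef g (adaptedSign (n - q) q) E (.inl a) (.inl c) (.inr i) x *
        -structCoef g (adaptedSign (n - q) q) E (.inl a) (.inl c) (.inr j) x)))
        = ∑ i, ∑ j, ∑ c, 1 * (1 * (frameCoord g (adaptedSign (n - q) q) E (.inr i) x v
        * frameCoord g (adaptedSign (n - q) q) E (.inr j) x w *
        (-structCoef g (adaptedSign (n - q) q) E (.inl a) (.inl c) (.inr i) x *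
        -structCoef g (adaptedSign (n - q) q) E (.inl a) (.inl c) (.inr j) x))) := by
      intro a
      rw [Finset.sum_comm]
      exact Finset.sum_congr rfl fun i _ => Finset.sum_comm
    simp_rw [this]
    rw [Finset.sum_comm]
    refine Finset.sum_congr rfl fun i _ => ?_
    rw [Finset.sum_comm]
    exact Finset.sum_congr rfl fun j _ => Finset.sum_congr rfl fun a _ =>
      Finset.sum_congr rfl fun l _ => by ring

end IsAdaptedFrame

end BForm

end SemiRiem

namespace SemiRiem

/-! ### The Ricci tensor of the stretched metric as a polynomial in `ε` -/

section ScaledRicci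

/-- The exponents of `ε` in the rescaling of an adapted frame. -/
def frameWeight {p q : ℕ} : Fin p ⊕ Fin q → ℕ := Sum.elim (fun _ => 0) (fun _ => 1)

/-- Structure coefficients of the rescaled frame, multiplied by `ε`. -/
def scaledCoef {p q : ℕ} (ε : ℝ) (C : Fin p ⊕ Fin q → Fin p ⊕ Fin q → Fin p ⊕ Fin q → ℝ)
    (i j k : Fin p ⊕ Fin q) : ℝ :=
  ε ^ (1 + frameWeight i + frameWeight j - frameWeight k) * C i j k

/-- Christoffel symbols as a function of the structure coefficients. -/
def christoffelOf {p q : ℕ} (c : Fin p ⊕ Fin q → Fin p ⊕ Fin q → Fin p ⊕ Fin q → ℝ)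
    (i j k : Fin p ⊕ Fin q) : ℝ :=
  1 / 2 * (c i j k - adaptedSign p q k * adaptedSign p q j * c i k j
    - adaptedSign p q k * adaptedSign p q i * c j k i)

/-- `ε²` times the Ricci tensor in the rescaled frame, as a polynomial in `ε`, in the structure
coefficients `C` of the adapted frame and in their derivatives `D`. -/
def ricPoly {p q : ℕ} (ε : ℝ) (C : Fin p ⊕ Fin q → Fin p ⊕ Fin q → Fin p ⊕ Fin q → ℝ)
    (D : Fin p ⊕ Fin q → Fin p ⊕ Fin q → Fin p ⊕ Fin q → Fin p ⊕ Fin q → ℝ)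
    (b j : Fin p ⊕ Fin q) : ℝ :=
  ∑ a, (ε * ε ^ frameWeight a * christoffelOf (scaledCoef ε (D a)) b j a
    - ε * ε ^ frameWeight b * christoffelOf (scaledCoef ε (D b)) a j a
    - ∑ i, scaledCoef ε C a b i * christoffelOf (scaledCoef ε C) i j a
    + ∑ l, (christoffelOf (scaledCoef ε C) b j l * christoffelOf (scaledCoef ε C) a l a
      - christoffelOf (scaledCoef ε C) a j l * christoffelOf (scaledCoef ε C) b l a))

lemma continuous_ricPoly {p q : ℕ} (b j : Fin p ⊕ Fin q) :
    Continuous fun z : ℝ × (Fin p ⊕ Fin q → Fin p ⊕ Fin q → Fin p ⊕ Fin q → ℝ) ×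
      (Fin p ⊕ Fin q → Fin p ⊕ Fin q → Fin p ⊕ Fin q → Fin p ⊕ Fin q → ℝ) =>
      ricPoly z.1 z.2.1 z.2.2 b j := by
  unfold ricPoly christoffelOf scaledCoef
  fun_prop

/-- The leading term of the rescaled Ricci tensor is `b / 4`. -/
lemma ricPoly_zero {p q : ℕ} {C : Fin p ⊕ Fin q → Fin p ⊕ Fin q → Fin p ⊕ Fin q → ℝ}
    (hC : ∀ i j k, C j i k = -C i j k)
    (D : Fin p ⊕ Fin q → Fin p ⊕ Fin q → Fin p ⊕ Fin q → Fin p ⊕ Fin q → ℝ)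
    (b j : Fin p ⊕ Fin q) : ricPoly 0 C D b j = 1 / 4 * bCoef C b j := by
  -- At `ε = 0` only coefficients with exponent `0` survive (`0 ^ 0 = 1`). The exponent `1 + w_i +
  -- w_j - w_k` vanishes only for `i`, `j` horizontal and `k` vertical.
  have h1 : ∀ (i j k : Fin p), scaledCoef 0 C (.inl i) (.inl j) (.inl k) = 0 := fun i j k => by
    simp [scaledCoef, frameWeight]
  have h2 : ∀ (i j : Fin p) (k : Fin q),
      scaledCoef 0 C (.inl i) (.inl j) (.inr k) = C (.inl i) (.inl j) (.inr k) := fun i j k => by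
    simp [scaledCoef, frameWeight]
  have h3 : ∀ (i : Fin p) (j : Fin q) k, scaledCoef 0 C (.inl i) (.inr j) k = 0 := fun i j k => by
    rcases k with k | k <;> simp [scaledCoef, frameWeight]
  have h4 : ∀ (i : Fin q) j k, scaledCoef 0 C (.inr i) j k = 0 := fun i j k => by
    rcases j with j | j <;> rcases k with k | k <;> simp [scaledCoef, frameWeight]
  unfold ricPoly
  simp only [Fintype.sum_sum_type, zero_mul, sub_zero, zero_sub]
  have h5 : ∀ i k, C i i k = 0 := fun i k => by linarith [hC i i k]
  -- The mixed components are closed by simplification, since each of their products contains a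
  -- vanishing symbol. The two diagonal blocks remain.
  rcases b with b | b <;> rcases j with j | j <;>
    simp only [christoffelOf, adaptedSign, h1, h2, h3, h4, h5, bCoef, Sum.elim_inl, Sum.elim_inr,
      zero_mul, mul_zero, one_mul, mul_one, sub_zero, zero_sub, add_zero, zero_add, neg_zero,
      neg_mul, mul_neg, neg_neg, Finset.sum_const_zero]
  · rw [Finset.sum_comm (s := (Finset.univ : Finset (Fin q))) (t := (Finset.univ : Finset (Fin p))),
      ← Finset.sum_add_distrib, Finset.mul_sum, Finset.mul_sum]
    refine Finset.sum_congr rfl fun a _ => ?_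
    simp only [Finset.mul_sum, ← Finset.sum_neg_distrib, ← Finset.sum_add_distrib]
    refine Finset.sum_congr rfl fun l _ => ?_
    rw [hC (.inl b) (.inl a), hC (.inl j) (.inl a)]
    ring
  · simp only [Finset.mul_sum]
    refine Finset.sum_congr rfl fun a _ => Finset.sum_congr rfl fun c _ => ?_
    rw [hC (.inl a) (.inl c) (.inr b)]
    ring

variable {n : ℕ} {M : Type*} [TopologicalSpace M] [ChartedSpace (EuclideanSpace ℝ (Fin n)) M]
  [IsManifold (𝓡 n) ∞ M]

omit [IsManifold (𝓡 n) ∞ M] in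
-- The Christoffel symbols are linear in the structure coefficients with constant coefficients, so
-- they commute with differentiation.
lemma dirDeriv_christoffelOf {p q : ℕ} {X : VField n M} {x : M} {ε : ℝ}
    {C : Fin p ⊕ Fin q → Fin p ⊕ Fin q → Fin p ⊕ Fin q → M → ℝ}
    (hC : ∀ i j k, SmoothFunAt n (C i j k) x) (i j k : Fin p ⊕ Fin q) :
    dirDeriv X (fun y => christoffelOf (scaledCoef ε fun i j k => C i j k y) i j k) x
      = christoffelOf (scaledCoef ε fun i j k => dirDeriv X (C i j k) x) i j k := by
  have hs : ∀ i j k, SmoothFunAt n (fun y => scaledCoef ε (fun i j k => C i j k y) i j k) x :=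
    fun i j k => (hC i j k).const_mul _
  have hd : ∀ i j k, dirDeriv X (fun y => scaledCoef ε (fun i j k => C i j k y) i j k) x
      = scaledCoef ε (fun i j k => dirDeriv X (C i j k) x) i j k :=
    fun i j k => dirDeriv_const_mul _ (hC i j k)
  have hsub : ∀ {f f' : M → ℝ}, SmoothFunAt n f x → SmoothFunAt n f' x →
      dirDeriv X (fun y => f y - f' y) x = dirDeriv X f x - dirDeriv X f' x := by
    intro f f' hf hf'
    have := dirDeriv_add (X := X) hf (hf'.const_mul (-1))
    rw [dirDeriv_const_mul _ hf'] at this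
    simp only [neg_mul, one_mul, ← sub_eq_add_neg] at this
    exact this
  unfold christoffelOf
  rw [dirDeriv_const_mul _ (((hs i j k).sub ((hs i k j).const_mul _)).sub
      ((hs j k i).const_mul _)),
    hsub ((hs i j k).sub ((hs i k j).const_mul _)) ((hs j k i).const_mul _),
    hsub (hs i j k) ((hs i k j).const_mul _), dirDeriv_const_mul _ (hs i k j),
    dirDeriv_const_mul _ (hs j k i), hd, hd, hd]

lemma frameScale_eq {p q : ℕ} (ε : ℝ) (i : Fin p ⊕ Fin q) :
    frameScale p q ε i = ε ^ frameWeight i := by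
  rcases i with i | i <;> simp [frameScale, frameWeight]

namespace IsAdaptedFrame

variable {g : BilinField n M} {q : ℕ} {H : SubspaceField n M}
  {E : Fin (n - q) ⊕ Fin q → VField n M} {U : Set M} (hE : IsAdaptedFrame g q H E U) {x : M}
  (hx : x ∈ U)
include hE hx

lemma mul_structCoef_stretch {ε : ℝ} (hε : ε ≠ 0) (i j k : Fin (n - q) ⊕ Fin q) :
    ε * structCoef (stretch g (fun _ => ε) (orthDistr g H)) (adaptedSign (n - q) q)
        (scaledFrame ε E) i j k x
      = scaledCoef ε (fun i j k => structCoef g (adaptedSign (n - q) q) E i j k x) i j k := by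
  rw [hE.structCoef_stretch hx hε, scaledCoef, frameScale_eq, frameScale_eq, frameScale_eq]
  -- The extra factor `ε` pays for the only negative power, so the natural-number subtraction in
  -- `scaledCoef` is never truncated.
  have hk : frameWeight k ≤ 1 + frameWeight i + frameWeight j := by
    have : frameWeight k ≤ 1 := by rcases k with k | k <;> simp [frameWeight]
    omega
  rw [pow_sub₀ ε hε hk]
  ring

lemma mul_christoffel_stretch {ε : ℝ} (hε : ε ≠ 0) (i j k : Fin (n - q) ⊕ Fin q) :
    ε * christoffel (stretch g (fun _ => ε) (orthDistr g H)) (adaptedSign (n - q) q)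
        (scaledFrame ε E) i j k x
      = christoffelOf (scaledCoef ε fun i j k => structCoef g (adaptedSign (n - q) q) E i j k x)
        i j k := by
  unfold christoffelOf
  rw [← hE.mul_structCoef_stretch hx hε, ← hE.mul_structCoef_stretch hx hε,
    ← hE.mul_structCoef_stretch hx hε, christoffel]
  ring

/-- One factor `ε` is moved inside the derivative to make the Christoffel symbol polynomial. The
other is left over and kills the derivative terms at `ε = 0`. -/
lemma mul_dirDeriv_christoffel_stretch {ε : ℝ} (hε : ε ≠ 0) (a i j k : Fin (n - q) ⊕ Fin q) :
    ε ^ 2 * dirDeriv (scaledFrame ε E a) (christoffel (stretch g (fun _ => ε) (orthDistr g H))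
        (adaptedSign (n - q) q) (scaledFrame ε E) i j k) x
      = ε * ε ^ frameWeight a * christoffelOf (scaledCoef ε fun i j k =>
        dirDeriv (E a) (structCoef g (adaptedSign (n - q) q) E i j k) x) i j k := by
  have h1 : dirDeriv (scaledFrame ε E a) (christoffel (stretch g (fun _ => ε) (orthDistr g H))
      (adaptedSign (n - q) q) (scaledFrame ε E) i j k) x
      = ε ^ frameWeight a * dirDeriv (E a) (christoffel (stretch g (fun _ => ε) (orthDistr g H))
      (adaptedSign (n - q) q) (scaledFrame ε E) i j k) x := by
    rw [← frameScale_eq]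
    exact dirDeriv_smul_left (a := fun _ => frameScale (n - q) q ε a)
  rw [← dirDeriv_christoffelOf (fun i j k => hE.smooth_structCoef hx i j k), h1]
  have h2 := dirDeriv_const_mul (X := E a) ε
    ((hE.isOrthoFrame_stretch hε).smooth_christoffel hx i j k)
  have h3 : dirDeriv (E a) (fun y => ε * christoffel (stretch g (fun _ => ε) (orthDistr g H))
      (adaptedSign (n - q) q) (scaledFrame ε E) i j k y) x
      = dirDeriv (E a) (fun y => christoffelOf (scaledCoef ε fun i j k =>
        structCoef g (adaptedSign (n - q) q) E i j k y) i j k) x := by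
    refine dirDeriv_congr ?_ rfl
    filter_upwards [hE.eventually_mem hx] with y hy
    exact hE.mul_christoffel_stretch hy hε i j k
  rw [← h3, h2]
  ring

/-- In the quadratic terms of the curvature each of the two factors absorbs one `ε`. -/
lemma mul_ricCoef_stretch {ε : ℝ} (hε : ε ≠ 0) (b j : Fin (n - q) ⊕ Fin q) :
    ε ^ 2 * ricCoef (stretch g (fun _ => ε) (orthDistr g H)) (adaptedSign (n - q) q)
        (scaledFrame ε E) b j x
      = ricPoly ε (fun i j k => structCoef g (adaptedSign (n - q) q) E i j k x)
        (fun a i j k => dirDeriv (E a) (structCoef g (adaptedSign (n - q) q) E i j k) x) b j := by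
  rw [ricCoef, ricPoly, Finset.mul_sum]
  refine Finset.sum_congr rfl fun a _ => ?_
  rw [← hE.mul_dirDeriv_christoffel_stretch hx hε, ← hE.mul_dirDeriv_christoffel_stretch hx hε]
  simp_rw [← hE.mul_christoffel_stretch hx hε, ← hE.mul_structCoef_stretch hx hε, curvCoef,
    mul_add, mul_sub, Finset.mul_sum]
  congr 1
  · congr 1
    exact Finset.sum_congr rfl fun i _ => by ring
  · exact Finset.sum_congr rfl fun l _ => by ring

end IsAdaptedFrame

end ScaledRicci

end SemiRiem

namespace SemiRiem

/-! ### Energy tensors and causal cones in orthonormal coordinates -/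

section Coordinates

variable {ι : Type*} [Fintype ι]

/-- The quadratic form with matrix `m`. -/
def quadOf (m : ι → ι → ℝ) (w : ι → ℝ) : ℝ := ∑ i, ∑ j, w i * w j * m i j

/-- Minus the squared length of the covector `m(w, ·)`. -/
def coquadOf (s : ι → ℝ) (m : ι → ι → ℝ) (w : ι → ℝ) : ℝ := -∑ k, s k * (∑ i, w i * m i k) ^ 2

/-- The matrix of `B - (1/2) tr(B) g` in an orthonormal basis, `b` being the matrix of `B`. -/
def einsteinCoef [DecidableEq ι] (s : ι → ℝ) (b : ι → ι → ℝ) (i j : ι) : ℝ :=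
  b i j - 1 / 2 * (∑ k, s k * b k k) * if i = j then s i else 0

lemma quadOf_smul (m : ι → ι → ℝ) (r : ℝ) (w : ι → ℝ) :
    quadOf m (r • w) = r ^ 2 * quadOf m w := by
  simp only [quadOf, Pi.smul_apply, smul_eq_mul, Finset.mul_sum]
  exact Finset.sum_congr rfl fun i _ => Finset.sum_congr rfl fun j _ => by ring

lemma coquadOf_smul (s : ι → ℝ) (m : ι → ι → ℝ) (r : ℝ) (w : ι → ℝ) :
    coquadOf s m (r • w) = r ^ 2 * coquadOf s m w := by
  simp only [coquadOf, Pi.smul_apply, smul_eq_mul, mul_assoc, ← Finset.mul_sum, mul_neg]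
  rw [Finset.mul_sum]
  congr 1
  exact Finset.sum_congr rfl fun k _ => by ring

lemma quadOf_mul (c : ℝ) (m : ι → ι → ℝ) (w : ι → ℝ) :
    quadOf (fun i j => c * m i j) w = c * quadOf m w := by
  simp only [quadOf, Finset.mul_sum]
  exact Finset.sum_congr rfl fun i _ => Finset.sum_congr rfl fun j _ => by ring

lemma coquadOf_mul (s : ι → ℝ) (c : ℝ) (m : ι → ι → ℝ) (w : ι → ℝ) :
    coquadOf s (fun i j => c * m i j) w = c ^ 2 * coquadOf s m w := by
  have : ∀ k, ∑ i, w i * (c * m i k) = c * ∑ i, w i * m i k := by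
    intro k
    rw [Finset.mul_sum]
    exact Finset.sum_congr rfl fun i _ => by ring
  simp_rw [coquadOf, this]
  rw [mul_neg, Finset.mul_sum]
  congr 1
  exact Finset.sum_congr rfl fun k _ => by ring

lemma continuous_quadOf {𝒜 : Type*} [TopologicalSpace 𝒜] {m : ℝ → 𝒜 → ι → ι → ℝ}
    (hm : ∀ i j, Continuous fun z : ℝ × 𝒜 => m z.1 z.2 i j) :
    Continuous fun z : ℝ × 𝒜 × (ι → ℝ) => quadOf (m z.1 z.2.1) z.2.2 := by
  have h : ∀ i j, Continuous fun z : ℝ × 𝒜 × (ι → ℝ) => m z.1 z.2.1 i j := fun i j =>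
    (hm i j).comp (g := fun z : ℝ × 𝒜 => m z.1 z.2 i j)
      (f := fun z : ℝ × 𝒜 × (ι → ℝ) => (z.1, z.2.1)) (by fun_prop)
  unfold quadOf
  fun_prop

lemma continuous_coquadOf {𝒜 : Type*} [TopologicalSpace 𝒜] (s : ι → ℝ) {m : ℝ → 𝒜 → ι → ι → ℝ}
    (hm : ∀ i j, Continuous fun z : ℝ × 𝒜 => m z.1 z.2 i j) :
    Continuous fun z : ℝ × 𝒜 × (ι → ℝ) => coquadOf s (m z.1 z.2.1) z.2.2 := by
  have h : ∀ i j, Continuous fun z : ℝ × 𝒜 × (ι → ℝ) => m z.1 z.2.1 i j := fun i j =>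
    (hm i j).comp (g := fun z : ℝ × 𝒜 => m z.1 z.2 i j)
      (f := fun z : ℝ × 𝒜 × (ι → ℝ) => (z.1, z.2.1)) (by fun_prop)
  unfold coquadOf
  fun_prop

lemma einsteinCoef_mul [DecidableEq ι] (s : ι → ℝ) (c : ℝ) (b : ι → ι → ℝ) (i j : ι) :
    einsteinCoef s (fun i j => c * b i j) i j = c * einsteinCoef s b i j := by
  have : ∑ k, s k * (c * b k k) = c * ∑ k, s k * b k k := by
    rw [Finset.mul_sum]
    exact Finset.sum_congr rfl fun i _ => by ring
  rw [einsteinCoef, einsteinCoef, this]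
  ring

variable {n : ℕ} {M : Type*} [TopologicalSpace M] [ChartedSpace (EuclideanSpace ℝ (Fin n)) M]
  [IsManifold (𝓡 n) ∞ M] [DecidableEq ι]

namespace IsOrthoFrame

variable {g : BilinField n M} {s : ι → ℝ} {E : ι → VField n M} {U : Set M}
  (hE : IsOrthoFrame g s E U) {x : M} (hx : x ∈ U)
include hE hx

lemma traceOn_top {B : TangentSpace (𝓡 n) x → TangentSpace (𝓡 n) x → ℝ} {b : ι → ι → ℝ}
    (hB : ∀ v w, B v w = ∑ i, ∑ j, frameCoord g s E i x v * frameCoord g s E j x w * b i j) :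
    traceOn (g x) ⊤ B = ∑ k, s k * b k k := by
  have h1 : ∀ i j, B (E i x) (E j x) = b i j := by
    intro i j
    rw [hB]
    simp_rw [hE.frameCoord_frame hx]
    simp
  rw [(hE.isOrthoFamily hx).traceOn_eq (hE.span_eq_top hx)]
  · simp_rw [h1]
  · intro c d
    simp_rw [h1, hB, hE.frameCoord_sum hx]

lemma einstein_eq {B : TangentSpace (𝓡 n) x → TangentSpace (𝓡 n) x → ℝ} {b : ι → ι → ℝ}
    (hB : ∀ v w, B v w = ∑ i, ∑ j, frameCoord g s E i x v * frameCoord g s E j x w * b i j)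
    (v w : TangentSpace (𝓡 n) x) :
    B v w - 1 / 2 * traceOn (g x) ⊤ B * g x v w
      = ∑ i, ∑ j, frameCoord g s E i x v * frameCoord g s E j x w * einsteinCoef s b i j := by
  rw [hB, hE.traceOn_top hx hB, hE.inner_eq hx, Finset.mul_sum, ← Finset.sum_sub_distrib]
  refine Finset.sum_congr rfl fun i _ => ?_
  simp_rw [einsteinCoef, mul_sub, Finset.sum_sub_distrib]
  congr 1
  simp
  ring

lemma energyMomentum_eq (Λ : ℝ) (v w : TangentSpace (𝓡 n) x) :
    energyMomentum g Λ x v w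
      = ∑ i, ∑ j, frameCoord g s E i x v * frameCoord g s E j x w *
        (einsteinCoef s (fun i j => ricCoef g s E i j x) i j + Λ * if i = j then s i else 0) := by
  rw [energyMomentum, scal, hE.einstein_eq hx (hE.ric_eq hx), hE.inner_eq hx, Finset.mul_sum,
    ← Finset.sum_add_distrib]
  refine Finset.sum_congr rfl fun i _ => ?_
  simp_rw [mul_add, Finset.sum_add_distrib]
  congr 1
  simp
  ring

/-- In an orthonormal frame raising an index multiplies the `k`-th component by `s k`; two such
factors cancel against `s k * s k = 1`, leaving one in the squared length. -/
lemma neg_inner_sharp {B : TangentSpace (𝓡 n) x → TangentSpace (𝓡 n) x → ℝ} {b : ι → ι → ℝ}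
    (hB : ∀ v w, B v w = ∑ i, ∑ j, frameCoord g s E i x v * frameCoord g s E j x w * b i j)
    (v : TangentSpace (𝓡 n) x) :
    -g x (sharp (g x) (B v)) (sharp (g x) (B v))
      = coquadOf s b fun i => frameCoord g s E i x v := by
  have h1 : sharp (g x) (B v)
      = ∑ k, (s k * ∑ i, frameCoord g s E i x v * b i k) • E k x := by
    refine sharp_eq (hE.nondeg hx) fun z => ?_
    rw [hE.inner_eq hx, hB, Finset.sum_comm]
    simp_rw [hE.frameCoord_sum hx, ← mul_assoc, hE.sign_mul_self, one_mul, Finset.sum_mul]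
    exact Finset.sum_congr rfl fun k _ => Finset.sum_congr rfl fun i _ => by ring
  rw [h1, hE.inner_eq hx, coquadOf]
  simp_rw [hE.frameCoord_sum hx]
  congr 1
  refine Finset.sum_congr rfl fun k _ => ?_
  linear_combination (s k * (∑ i, frameCoord g s E i x v * b i k) ^ 2) * hE.sign_mul_self k

/-- The cone depends only on the signs. Since the rescaled frame keeps the signs, the cone in
coordinates is the same for all `ε`. -/
lemma isCausal_iff (v : TangentSpace (𝓡 n) x) :
    IsCausal (g x) v ↔ (fun i => frameCoord g s E i x v) ≠ 0 ∧
      ∑ i, s i * frameCoord g s E i x v ^ 2 ≤ 0 := by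
  have h1 : g x v v = ∑ i, s i * frameCoord g s E i x v ^ 2 := by
    rw [hE.inner_eq hx]
    exact Finset.sum_congr rfl fun i _ => by ring
  have h2 : (fun i => frameCoord g s E i x v) = 0 ↔ v = 0 := by
    refine ⟨fun h => hE.ext_coord hx fun k => ?_, fun h => ?_⟩
    · rw [map_zero]
      exact congrFun h k
    · funext k
      rw [h, map_zero]
      rfl
  rw [ne_eq, h2, ← h1, IsCausal, IsTimelike, IsLightlike]
  constructor
  · rintro (h | h)
    · refine ⟨fun h0 => ?_, h.le⟩
      rw [h0, map_zero] at h
      exact lt_irrefl _ h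
    · exact ⟨h.2, h.1.le⟩
  · rintro ⟨h, h'⟩
    rcases h'.lt_or_eq with h3 | h3
    · exact Or.inl h3
    · exact Or.inr ⟨h3, h⟩

end IsOrthoFrame

end Coordinates

/-! ### Compactness arguments -/

section Uniformity

/-- Compactness reduces to finitely many neighbourhoods, and the minimum of their thresholds works.
-/
lemma exists_uniform {M : Type*} [TopologicalSpace M] {K : Set M} (hK : IsCompact K)
    {R : ℝ → M → Prop} (hR : ∀ x₀ ∈ K, ∃ ε₀ : ℝ, 0 < ε₀ ∧ ∀ᶠ x in 𝓝 x₀, x ∈ K →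
      ∀ ε ∈ Ioc 0 ε₀, R ε x) :
    ∃ ε₀ : ℝ, 0 < ε₀ ∧ ∀ ε ∈ Ioc 0 ε₀, ∀ x ∈ K, R ε x := by
  refine hK.induction_on (p := fun S => ∃ ε₀ : ℝ, 0 < ε₀ ∧ ∀ ε ∈ Ioc 0 ε₀, ∀ x ∈ S, R ε x)
    ⟨1, one_pos, fun _ _ _ h => h.elim⟩ ?_ ?_ ?_
  · rintro S T hST ⟨ε₀, h0, h⟩
    exact ⟨ε₀, h0, fun ε hε x hx => h ε hε x (hST hx)⟩
  · rintro S T ⟨ε₁, h1, h1'⟩ ⟨ε₂, h2, h2'⟩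
    refine ⟨min ε₁ ε₂, lt_min h1 h2, fun ε hε x hx => ?_⟩
    rcases hx with hx | hx
    · exact h1' ε ⟨hε.1, hε.2.trans (min_le_left _ _)⟩ x hx
    · exact h2' ε ⟨hε.1, hε.2.trans (min_le_right _ _)⟩ x hx
  · intro x₀ hx₀
    obtain ⟨ε₀, h0, h⟩ := hR x₀ hx₀
    refine ⟨{x | x ∈ K → ∀ ε ∈ Ioc 0 ε₀, R ε x} ∩ K,
      Filter.inter_mem (mem_nhdsWithin_of_mem_nhds h) self_mem_nhdsWithin, ε₀, h0, ?_⟩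
    exact fun ε hε x hx => hx.1 hx.2 ε hε

/-- Strict positivity of a continuous family of homogeneous functions on a cone persists for small
parameters. -/
lemma eventually_pos_of_homogeneous {M 𝒜 ι : Type*} [TopologicalSpace M] [TopologicalSpace 𝒜]
    [Fintype ι] {P : ℝ → 𝒜 → (ι → ℝ) → ℝ}
    (hP : Continuous fun z : ℝ × 𝒜 × (ι → ℝ) => P z.1 z.2.1 z.2.2)
    (hom : ∀ ε a (r : ℝ) w, P ε a (r • w) = r ^ 2 * P ε a w) {A : M → 𝒜} {x₀ : M}
    (hA : ContinuousAt A x₀) (s : ι → ℝ) {c : ℝ} (hc : 0 < c) {K : Set M}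
    (hK : ∀ x ∈ K, ∀ w : ι → ℝ, ∑ i, w i ^ 2 = 1 → ∑ i, s i * w i ^ 2 ≤ 0 → c ≤ P 0 (A x) w) :
    ∃ ε₀ : ℝ, 0 < ε₀ ∧ ∀ᶠ x in 𝓝 x₀, x ∈ K → ∀ ε ∈ Ioc 0 ε₀, ∀ w : ι → ℝ, w ≠ 0 →
      ∑ i, s i * w i ^ 2 ≤ 0 → 0 < P ε (A x) w := by
  have hS : IsCompact {w : ι → ℝ | ∑ i, w i ^ 2 = 1} := by
    refine Metric.isCompact_of_isClosed_isBounded ?_ ?_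
    · exact isClosed_eq (by fun_prop) continuous_const
    · refine (Metric.isBounded_closedBall (x := (0 : ι → ℝ)) (r := 1)).subset fun w hw => ?_
      rw [mem_closedBall_zero_iff, pi_norm_le_iff_of_nonneg zero_le_one]
      intro i
      rw [Real.norm_eq_abs, ← sq_le_one_iff_abs_le_one]
      calc w i ^ 2 ≤ ∑ i, w i ^ 2 :=
            Finset.single_le_sum (f := fun i => w i ^ 2) (fun i _ => sq_nonneg _)
              (Finset.mem_univ i)
        _ = 1 := hw
  -- The comparison is with `P 0` at the same point, because the lower bound `c` is available at
  -- every point of `K`. Compactness of the sphere makes the estimate uniform in `w`.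
  have hev : ∀ᶠ z : ℝ × M in 𝓝 ((0 : ℝ), x₀), ∀ w ∈ {w : ι → ℝ | ∑ i, w i ^ 2 = 1},
      |P z.1 (A z.2) w - P 0 (A z.2) w| < c := by
    refine hS.eventually_forall_of_forall_eventually fun w _ => ?_
    have hA' : ContinuousAt (fun z : (ℝ × M) × (ι → ℝ) => A z.1.2) (((0 : ℝ), x₀), w) :=
      ContinuousAt.comp (f := fun z : (ℝ × M) × (ι → ℝ) => z.1.2) hA (by fun_prop)
    have h1 : ContinuousAt (fun z : (ℝ × M) × (ι → ℝ) => P z.1.1 (A z.1.2) z.2)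
        (((0 : ℝ), x₀), w) :=
      hP.continuousAt.comp (f := fun z : (ℝ × M) × (ι → ℝ) => (z.1.1, A z.1.2, z.2))
        (by fun_prop)
    have h2 : ContinuousAt (fun z : (ℝ × M) × (ι → ℝ) => P 0 (A z.1.2) z.2)
        (((0 : ℝ), x₀), w) :=
      hP.continuousAt.comp (f := fun z : (ℝ × M) × (ι → ℝ) => ((0 : ℝ), A z.1.2, z.2))
        (by fun_prop)
    have h3 := (h1.sub h2).abs
    refine h3.eventually (gt_mem_nhds ?_)
    simpa using hc
  rw [nhds_prod_eq, Filter.eventually_prod_iff] at hev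
  obtain ⟨pa, hpa, pb, hpb, h⟩ := hev
  obtain ⟨δ, hδ, hball⟩ := Metric.eventually_nhds_iff.1 hpa
  -- The ball is open while the interval includes its right end point, hence the half.
  refine ⟨δ / 2, half_pos hδ, ?_⟩
  filter_upwards [hpb] with x hx hxK ε hε w hw hws
  have hpos : 0 < ∑ i, w i ^ 2 := by
    obtain ⟨i, hi⟩ := Function.ne_iff.1 hw
    exact Finset.sum_pos' (fun i _ => sq_nonneg _) ⟨i, Finset.mem_univ i, sq_pos_iff.2 hi⟩
  set r := √(∑ i, w i ^ 2) with hr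
  have hr0 : 0 < r := Real.sqrt_pos.2 hpos
  have hr2 : r ^ 2 = ∑ i, w i ^ 2 := Real.sq_sqrt hpos.le
  have hw' : w = r • (r⁻¹ • w) := by rw [smul_smul, mul_inv_cancel₀ hr0.ne', one_smul]
  have hu : ∑ i, (r⁻¹ • w) i ^ 2 = 1 := by
    simp only [Pi.smul_apply, smul_eq_mul, mul_pow, ← Finset.mul_sum]
    rw [← hr2, ← mul_pow, inv_mul_cancel₀ hr0.ne', one_pow]
  have hus : ∑ i, s i * (r⁻¹ • w) i ^ 2 ≤ 0 := by
    have : ∑ i, s i * (r⁻¹ • w) i ^ 2 = r⁻¹ ^ 2 * ∑ i, s i * w i ^ 2 := by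
      rw [Finset.mul_sum]
      exact Finset.sum_congr rfl fun i _ => by rw [Pi.smul_apply, smul_eq_mul]; ring
    rw [this]
    exact mul_nonpos_of_nonneg_of_nonpos (by positivity) hws
  have h1 := h (hball (y := ε) (by
    rw [Real.dist_eq, sub_zero, abs_of_pos hε.1]
    linarith [hε.2])) hx _ hu
  have h2 := hK x hxK _ hu hus
  rw [hw', hom]
  have h3 := (abs_lt.1 h1).1
  have h4 : 0 < P ε (A x) (r⁻¹ • w) := by
    simp only at h3
    linarith
  positivity

end Uniformity

/-! ### Passage to the limit and the four conditions -/

section Main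

variable {n : ℕ} {M : Type*} [TopologicalSpace M] [ChartedSpace (EuclideanSpace ℝ (Fin n)) M]
  [IsManifold (𝓡 n) ∞ M]

/-- Values of the structure coefficients of an adapted frame and of their derivatives. -/
abbrev FrameDatum (p q : ℕ) : Type :=
  (Fin p ⊕ Fin q → Fin p ⊕ Fin q → Fin p ⊕ Fin q → ℝ) ×
    (Fin p ⊕ Fin q → Fin p ⊕ Fin q → Fin p ⊕ Fin q → Fin p ⊕ Fin q → ℝ)

/-- Structure coefficients of an adapted frame together with their derivatives. -/
def frameData (g : BilinField n M) {q : ℕ} (E : Fin (n - q) ⊕ Fin q → VField n M) (x : M) :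
    FrameDatum (n - q) q :=
  (fun i j k => structCoef g (adaptedSign (n - q) q) E i j k x,
    fun a i j k => dirDeriv (E a) (structCoef g (adaptedSign (n - q) q) E i j k) x)

/-- `ε²` times the matrix of the energy-momentum tensor in the rescaled frame. -/
def emPoly {p q : ℕ} (Λ ε : ℝ) (A : FrameDatum p q)
    (i j : Fin p ⊕ Fin q) : ℝ :=
  einsteinCoef (adaptedSign p q) (ricPoly ε A.1 A.2) i j
    + ε ^ 2 * Λ * if i = j then adaptedSign p q i else 0

namespace IsAdaptedFrame

variable {g : BilinField n M} {q : ℕ} {H : SubspaceField n M}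
  {E : Fin (n - q) ⊕ Fin q → VField n M} {U : Set M} (hE : IsAdaptedFrame g q H E U) {x : M}
  (hx : x ∈ U)
include hE hx

lemma continuousAt_frameData : ContinuousAt (frameData g E) x := by
  refine ContinuousAt.prodMk ?_ ?_
  · exact continuousAt_pi.2 fun i => continuousAt_pi.2 fun j => continuousAt_pi.2 fun k =>
      (hE.smooth_structCoef hx i j k).continuousAt
  · exact continuousAt_pi.2 fun a => continuousAt_pi.2 fun i => continuousAt_pi.2 fun j =>
      continuousAt_pi.2 fun k =>
        (hE.smooth_dirDeriv hx (hE.smooth x hx a) (hE.smooth_structCoef hx i j k)).continuousAt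

omit [IsManifold (𝓡 n) ∞ M] hE hx in
lemma ricPoly_frameData_zero (b j : Fin (n - q) ⊕ Fin q) :
    ricPoly 0 (frameData g E x).1 (frameData g E x).2 b j
      = 1 / 4 * bCoef (frameData g E x).1 b j :=
  ricPoly_zero (C := (frameData g E x).1)
    (fun i j k => structCoef_swap g (adaptedSign (n - q) q) E i j k x) _ b j

omit [IsManifold (𝓡 n) ∞ M] hE hx in
lemma emPoly_frameData_zero (Λ : ℝ) :
    emPoly Λ 0 (frameData g E x)
      = fun i j => 1 / 4 * einsteinCoef (adaptedSign (n - q) q) (bCoef (frameData g E x).1) i j := by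
  funext i j
  have h : ricPoly 0 (frameData g E x).1 (frameData g E x).2
      = fun i j => 1 / 4 * bCoef (frameData g E x).1 i j := by
    funext b j
    exact ricPoly_frameData_zero b j
  rw [emPoly, h, einsteinCoef_mul]
  ring

lemma mul_ric_stretch {ε : ℝ} (hε : ε ≠ 0) (v : TangentSpace (𝓡 n) x) :
    ε ^ 2 * ric (stretch g (fun _ => ε) (orthDistr g H)) x v v
      = quadOf (ricPoly ε (frameData g E x).1 (frameData g E x).2)
        fun i => frameCoord (stretch g (fun _ => ε) (orthDistr g H)) (adaptedSign (n - q) q)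
          (scaledFrame ε E) i x v := by
  rw [(hE.isOrthoFrame_stretch hε).ric_eq hx, quadOf, Finset.mul_sum]
  refine Finset.sum_congr rfl fun i _ => ?_
  rw [Finset.mul_sum]
  refine Finset.sum_congr rfl fun j _ => ?_
  rw [mul_left_comm, hE.mul_ricCoef_stretch hx hε, frameData]

lemma emPoly_eq {ε : ℝ} (hε : ε ≠ 0) (Λ : ℝ) :
    emPoly Λ ε (frameData g E x) = fun i j => ε ^ 2 *
      (einsteinCoef (adaptedSign (n - q) q) (fun i j => ricCoef
        (stretch g (fun _ => ε) (orthDistr g H)) (adaptedSign (n - q) q) (scaledFrame ε E) i j x) i j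
        + Λ * if i = j then adaptedSign (n - q) q i else 0) := by
  funext i j
  have h : ricPoly ε (frameData g E x).1 (frameData g E x).2 = fun i j => ε ^ 2 * ricCoef
        (stretch g (fun _ => ε) (orthDistr g H)) (adaptedSign (n - q) q) (scaledFrame ε E) i j x := by
    funext i j
    rw [hE.mul_ricCoef_stretch hx hε, frameData]
  rw [emPoly, h, einsteinCoef_mul]
  ring

lemma hNorm_eq (v : TangentSpace (𝓡 n) x) :
    hNorm g H x v = √(∑ i, frameCoord g (adaptedSign (n - q) q) E i x v ^ 2) := by
  rw [hNorm, hE.switch_apply hx]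
  congr 1
  exact Finset.sum_congr rfl fun i _ => by ring

lemma betaForm_eq (v w : TangentSpace (𝓡 n) x) :
    betaForm g H x v w = ∑ i, ∑ j, frameCoord g (adaptedSign (n - q) q) E i x v
      * frameCoord g (adaptedSign (n - q) q) E j x w
      * einsteinCoef (adaptedSign (n - q) q) (bCoef (frameData g E x).1) i j :=
  hE.einstein_eq hx (hE.bForm_eq hx) v w

end IsAdaptedFrame

/-- Uniform positivity over a compact set, transferred from the limit `ε = 0` to small stretching
factors. -/
theorem exists_stretch_of_limit {g : BilinField n M} {q : ℕ} (hg : IsSemiRiemannianMetric g q)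
    {H : SubspaceField n M} (hH : IsSpaceDistribution g q H) {K : Set M} (hK : IsCompact K)
    {P : ℝ → FrameDatum (n - q) q → (Fin (n - q) ⊕ Fin q → ℝ) → ℝ}
    (hP : Continuous fun z : ℝ × FrameDatum (n - q) q × (Fin (n - q) ⊕ Fin q → ℝ) =>
      P z.1 z.2.1 z.2.2)
    (hom : ∀ ε a (r : ℝ) w, P ε a (r • w) = r ^ 2 * P ε a w) {c : ℝ} (hc : 0 < c)
    {N : Π x : M, TangentSpace (𝓡 n) x → ℝ}
    (hN : ∀ x ∈ K, ∀ v, IsCausal (g x) v → 1 ≤ hNorm g H x v → c ≤ N x v)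
    (hNP : ∀ (E : Fin (n - q) ⊕ Fin q → VField n M) (U : Set M), IsAdaptedFrame g q H E U →
      ∀ x ∈ U, ∀ v, N x v ≤ P 0 (frameData g E x)
        fun i => frameCoord g (adaptedSign (n - q) q) E i x v)
    {R : ℝ → Π x : M, TangentSpace (𝓡 n) x → Prop}
    (hR : ∀ (E : Fin (n - q) ⊕ Fin q → VField n M) (U : Set M), IsAdaptedFrame g q H E U →
      ∀ x ∈ U, ∀ ε, 0 < ε → ∀ v, (0 < P ε (frameData g E x) fun i =>
        frameCoord (stretch g (fun _ => ε) (orthDistr g H)) (adaptedSign (n - q) q)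
          (scaledFrame ε E) i x v) → R ε x v) :
    ∃ ε₀ : ℝ, 0 < ε₀ ∧ ∀ ε ∈ Ioc 0 ε₀, ∀ x ∈ K, ∀ v,
      IsCausal (stretch g (fun _ => ε) (orthDistr g H) x) v → R ε x v := by
  refine exists_uniform hK fun x₀ _ => ?_
  obtain ⟨U, E, hx₀, hE⟩ := exists_adaptedFrame hg hH x₀
  obtain ⟨ε₀, h0, hev⟩ := eventually_pos_of_homogeneous hP hom (hE.continuousAt_frameData hx₀)
    (adaptedSign (n - q) q) hc (K := K ∩ U) (fun x hx w hw1 hw2 => by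
      -- A unit coordinate vector `w` in the cone is realized by a `g`-causal vector with `h`-norm
      -- `1`, to which niceness applies.
      have hcoord : (fun i => frameCoord g (adaptedSign (n - q) q) E i x (∑ i, w i • E i x)) = w :=
        funext fun k => hE.frameCoord_sum hx.2 w k
      have h1 : IsCausal (g x) (∑ i, w i • E i x) := by
        refine (hE.isCausal_iff hx.2 _).2 ⟨?_, ?_⟩
        · rw [hcoord]
          rintro rfl
          simp at hw1
        · simp_rw [hE.frameCoord_sum hx.2]
          exact hw2
      have h2 : hNorm g H x (∑ i, w i • E i x) = 1 := by
        rw [hE.hNorm_eq hx.2]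
        simp_rw [hE.frameCoord_sum hx.2]
        rw [hw1, Real.sqrt_one]
      have h3 := hNP E U hE x hx.2 (∑ i, w i • E i x)
      rw [hcoord] at h3
      exact (hN x hx.1 _ h1 h2.ge).trans h3)
  refine ⟨ε₀, h0, ?_⟩
  filter_upwards [hev, hE.eventually_mem hx₀] with x hx hxU hxK ε hε v hv
  -- From here on coordinates refer to the rescaled frame: a vector causal for the stretched metric
  -- has its coordinates there in the same cone.
  have hcausal := ((hE.isOrthoFrame_stretch hε.1.ne').isCausal_iff hxU v).1 hv
  exact hR E U hE x hxU ε hε.1 v (hx ⟨hxK, hxU⟩ ε hε _ hcausal.1 hcausal.2)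

lemma continuous_emPoly {p q : ℕ} (Λ : ℝ) (i j : Fin p ⊕ Fin q) :
    Continuous fun z : ℝ × FrameDatum p q =>
      emPoly Λ z.1 z.2 i j := by
  unfold emPoly einsteinCoef
  have := @continuous_ricPoly p q
  fun_prop

theorem exists_stretch_causalConvergence {g : BilinField n M} {q : ℕ}
    (hg : IsSemiRiemannianMetric g q) {H : SubspaceField n M} (hH : IsSpaceDistribution g q H)
    {K : Set M} (hK : IsCompact K) (hnice : CausalConvergenceNiceOn g H K) :
    ∃ ε₀ : ℝ, 0 < ε₀ ∧ ∀ ε ∈ Ioc 0 ε₀,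
      StrictCausalConvergenceOn (stretch g (fun _ => ε) (orthDistr g H)) K := by
  obtain ⟨c, hc, hnice⟩ := hnice
  obtain ⟨ε₀, h0, h⟩ := exists_stretch_of_limit hg hH hK
    (P := fun ε A w => quadOf (ricPoly ε A.1 A.2) w) (c := 1 / 4 * c)
    (N := fun x v => 1 / 4 * bForm g H x v v)
    (R := fun ε x v => 0 < ric (stretch g (fun _ => ε) (orthDistr g H)) x v v)
    (continuous_quadOf (m := fun ε (A : FrameDatum (n - q) q) => ricPoly ε A.1 A.2)
      continuous_ricPoly)
    (fun ε A r w => quadOf_smul _ r w) (by positivity)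
    (fun x hx v hv hv1 => by linarith [hnice x hx v hv hv1])
    (fun E U hE x hx v => by
      have h1 : ricPoly 0 (frameData g E x).1 (frameData g E x).2
          = fun i j => 1 / 4 * bCoef (frameData g E x).1 i j :=
        funext fun b => funext fun j => IsAdaptedFrame.ricPoly_frameData_zero b j
      rw [h1, quadOf_mul, hE.bForm_eq hx]
      exact le_rfl)
    (fun E U hE x hx ε hε v hpos => by
      rw [← hE.mul_ric_stretch hx hε.ne'] at hpos
      exact (mul_pos_iff_of_pos_left (by positivity)).1 hpos)
  exact ⟨ε₀, h0, fun ε hε => ⟨fun x hx v hv => h ε hε x hx v (Or.inr hv),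
    fun x hx v hv => h ε hε x hx v (Or.inl hv)⟩⟩

/-- The term with `Λ` enters `emPoly` with the factor `ε²`, so the limit is `β / 4` whatever `Λ` is.
-/
theorem exists_stretch_weakEnergy {g : BilinField n M} {q : ℕ}
    (hg : IsSemiRiemannianMetric g q) {H : SubspaceField n M} (hH : IsSpaceDistribution g q H)
    {K : Set M} (hK : IsCompact K) (Λ : ℝ) (hnice : WeakEnergyNiceOn g H K) :
    ∃ ε₀ : ℝ, 0 < ε₀ ∧ ∀ ε ∈ Ioc 0 ε₀,
      StrictWeakEnergyOn (stretch g (fun _ => ε) (orthDistr g H)) Λ K := by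
  obtain ⟨c, hc, hnice⟩ := hnice
  exact exists_stretch_of_limit hg hH hK
    (P := fun ε A w => quadOf (emPoly Λ ε A) w) (c := 1 / 4 * c)
    (N := fun x v => 1 / 4 * betaForm g H x v v)
    (R := fun ε x v => 0 < energyMomentum (stretch g (fun _ => ε) (orthDistr g H)) Λ x v v)
    (continuous_quadOf (m := fun ε (A : FrameDatum (n - q) q) => emPoly Λ ε A)
      (continuous_emPoly Λ))
    (fun ε A r w => quadOf_smul _ r w) (by positivity)
    (fun x hx v hv hv1 => by linarith [hnice x hx v hv hv1])
    (fun E U hE x hx v => by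
      rw [IsAdaptedFrame.emPoly_frameData_zero, quadOf_mul, hE.betaForm_eq hx]
      exact le_rfl)
    (fun E U hE x hx ε hε v hpos => by
      rw [hE.emPoly_eq hx hε.ne', quadOf_mul] at hpos
      rw [(hE.isOrthoFrame_stretch hε.ne').energyMomentum_eq hx]
      exact (mul_pos_iff_of_pos_left (by positivity)).1 hpos)

/-- The squared length of the covector is quadratic in the tensor, so the limit constant is `(1/4)²`
and the scaling factor is `(ε²)²`. The sign in front of `♯` does not affect being timelike. -/
theorem exists_stretch_semiDominantEnergy {g : BilinField n M} {q : ℕ}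
    (hg : IsSemiRiemannianMetric g q) {H : SubspaceField n M} (hH : IsSpaceDistribution g q H)
    {K : Set M} (hK : IsCompact K) (Λ : ℝ) (hnice : SemiDominantEnergyNiceOn g H K) :
    ∃ ε₀ : ℝ, 0 < ε₀ ∧ ∀ ε ∈ Ioc 0 ε₀,
      StrictSemiDominantEnergyOn (stretch g (fun _ => ε) (orthDistr g H)) Λ K := by
  obtain ⟨c, hc, hnice⟩ := hnice
  exact exists_stretch_of_limit hg hH hK
    (P := fun ε A w => coquadOf (adaptedSign (n - q) q) (emPoly Λ ε A) w) (c := (1 / 4) ^ 2 * c)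
    (N := fun x v => (1 / 4) ^ 2 *
      -g x (sharp (g x) (betaForm g H x v)) (sharp (g x) (betaForm g H x v)))
    (R := fun ε x v => IsTimelike (stretch g (fun _ => ε) (orthDistr g H) x)
      (-sharp (stretch g (fun _ => ε) (orthDistr g H) x)
        (energyMomentum (stretch g (fun _ => ε) (orthDistr g H)) Λ x v)))
    (continuous_coquadOf _ (m := fun ε (A : FrameDatum (n - q) q) => emPoly Λ ε A)
      (continuous_emPoly Λ))
    (fun ε A r w => coquadOf_smul _ _ r w) (by positivity)
    (fun x hx v hv hv1 => mul_le_mul_of_nonneg_left (hnice x hx v hv hv1) (by positivity))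
    (fun E U hE x hx v => by
      rw [IsAdaptedFrame.emPoly_frameData_zero, coquadOf_mul, hE.neg_inner_sharp hx (hE.betaForm_eq hx)])
    (fun E U hE x hx ε hε v hpos => by
      have hF := hE.isOrthoFrame_stretch hε.ne'
      rw [hE.emPoly_eq hx hε.ne', coquadOf_mul,
        ← hF.neg_inner_sharp hx (hF.energyMomentum_eq hx Λ)] at hpos
      have h1 := (mul_pos_iff_of_pos_left (by positivity)).1 hpos
      rw [IsTimelike, map_neg, map_neg, LinearMap.neg_apply, neg_neg]
      exact neg_pos.1 h1)

end Main

end SemiRiem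

end

theorem proposition6p3 {n : ℕ} {M : Type*} [TopologicalSpace M] [T2Space M]
    [ChartedSpace (EuclideanSpace ℝ (Fin n)) M] [IsManifold (𝓡 n) ∞ M]
    (g : SemiRiem.BilinField n M) (q : ℕ) (hg : SemiRiem.IsSemiRiemannianMetric g q)
    (H : SemiRiem.SubspaceField n M) (hH : SemiRiem.IsSpaceDistribution g q H)
    (V : SemiRiem.SubspaceField n M) (hV : V = SemiRiem.orthDistr g H)
    (K : Set M) (hK : IsCompact K) (Λ : ℝ) :
    (SemiRiem.WeakEnergyNiceOn g H K →
      ∃ ε₀ : ℝ, 0 < ε₀ ∧ ∀ ε ∈ Set.Ioc 0 ε₀,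
        SemiRiem.StrictWeakEnergyOn (SemiRiem.stretch g (fun _ => ε) V) Λ K) ∧
    (SemiRiem.SemiDominantEnergyNiceOn g H K →
      ∃ ε₀ : ℝ, 0 < ε₀ ∧ ∀ ε ∈ Set.Ioc 0 ε₀,
        SemiRiem.StrictSemiDominantEnergyOn (SemiRiem.stretch g (fun _ => ε) V) Λ K) ∧
    (SemiRiem.DominantEnergyNiceOn g H K →
      ∃ ε₀ : ℝ, 0 < ε₀ ∧ ∀ ε ∈ Set.Ioc 0 ε₀,
        SemiRiem.StrictDominantEnergyOn (SemiRiem.stretch g (fun _ => ε) V) Λ K) ∧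
    (SemiRiem.CausalConvergenceNiceOn g H K →
      ∃ ε₀ : ℝ, 0 < ε₀ ∧ ∀ ε ∈ Set.Ioc 0 ε₀,
        SemiRiem.StrictCausalConvergenceOn (SemiRiem.stretch g (fun _ => ε) V) K) := by
  subst hV
  refine ⟨SemiRiem.exists_stretch_weakEnergy hg hH hK Λ,
    SemiRiem.exists_stretch_semiDominantEnergy hg hH hK Λ, fun h => ?_,
    SemiRiem.exists_stretch_causalConvergence hg hH hK⟩
  obtain ⟨ε₁, h₁, h₁'⟩ := SemiRiem.exists_stretch_weakEnergy hg hH hK Λ h.1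
  obtain ⟨ε₂, h₂, h₂'⟩ := SemiRiem.exists_stretch_semiDominantEnergy hg hH hK Λ h.2
  exact ⟨min ε₁ ε₂, lt_min h₁ h₂, fun ε hε =>
    ⟨h₁' ε ⟨hε.1, hε.2.trans (min_le_left _ _)⟩, h₂' ε ⟨hε.1, hε.2.trans (min_le_right _ _)⟩⟩⟩
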